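/- Let $G=(V,E)$ be a locally finite simple graph without isolated vertices, let $\lambda>0$ and $\mu>0$, and let $K\subset V$ be finite. Every vertex of $G$ carries a stack of independent instructions: an instruction at $y$ is "sleep" with probability $\frac{\lambda}{1+\lambda}$, and "jump to $z$" with probability $\frac{1}{(1+\lambda)\deg(y)}$ for each neighbour $z$ of $y$. Independently of the instructions, the numbers of particles initially present at the vertices are independent Poisson variables with mean $\mu$, and all particles are initially active. Toppling a vertex $y$ means performing the next unused instruction at $y$: "jump to $z$" moves one active particle from $y$ to $z$ and wakes up any particle sleeping at $z$; "sleep" turns the particle at $y$ into a sleeping one if it is the only particle at $y$, and otherwise has no effect. The toppling is legal if $y$ hosts at least one active particle. To stabilize $K$ is to perform a finite sequence of legal topplings at vertices of $K$ after which no vertex of $K$ hosts an active particle; the resulting configuration does not depend on the sequence. Let $Q(x,K)$ be the probability that $K$ is stabilized by such a sequence and that $x$ then hosts a sleeping particle. Let $G_{K^c}(x,x)=E_x\big(\sum_{t=0}^{\tau_{K^c}-1}\mathbf 1\{X(t)=x\}\big)\in[0,\infty]$, where $X$ is discrete-time simple random walk on $G$ started at $x$ and $\tau_{K^c}=\inf\{t\ge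 0: X(t)\notin K\}$ (with $\inf\emptyset=\infty$). Then, for every $x\in K$ and every positive integer $H$, $$Q(x,K)\;\le\; 1-\Big(1-\frac{G_{K^c}(x,x)}{H+1}\Big)\Big(\frac{1}{1+\lambda}\Big)^{H},$$ where the right-hand side is read as $+\infty$ if $G_{K^c}(x,x)=\infty$. -/

import Mathlib

open MeasureTheory ProbabilityTheory
open scoped ENNReal NNReal

noncomputable section

namespace ARW

variable {V : Type*}

/-! ### Simple random walk and the killed Green function -/

/-- One step of simple random walk: a uniformly chosen neighbour of `v`.
(At an isolated vertex, a case that is excluded later, the walk is set to stay put.) -/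
def stepLaw (G : SimpleGraph V) [G.LocallyFinite] (v : V) : PMF V :=
  open Classical in
  if h : (G.neighborFinset v).Nonempty then PMF.uniformOfFinset (G.neighborFinset v) h
  else PMF.pure v

/-- The transition kernel of simple random walk, as a kernel from the past `(X 0, …, X n)`
to `X (n + 1)`. -/
def walkKernel (G : SimpleGraph V) [G.LocallyFinite] [MeasurableSpace V]
    [DiscreteMeasurableSpace V] (n : ℕ) : Kernel ((_ : Finset.Iic n) → V) V where
  toFun p := (stepLaw G (p ⟨n, Finset.mem_Iic.2 le_rfl⟩)).toMeasure
  measurable' :=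
    (Measurable.of_discrete (f := fun v : V => (stepLaw G v).toMeasure)).comp
      (measurable_pi_apply _)

instance (G : SimpleGraph V) [G.LocallyFinite] [MeasurableSpace V]
    [DiscreteMeasurableSpace V] (n : ℕ) : IsMarkovKernel (walkKernel G n) :=
  ⟨fun p => by
    change IsProbabilityMeasure (stepLaw G (p ⟨n, Finset.mem_Iic.2 le_rfl⟩)).toMeasure
    infer_instance⟩

/-- The law `P_x` on trajectories `ℕ → V` of simple random walk started at `x`. -/
def walkLaw (G : SimpleGraph V) [G.LocallyFinite] [MeasurableSpace V]
    [DiscreteMeasurableSpace V] (x : V) : Measure (ℕ → V) :=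
  Kernel.traj (X := fun _ => V) (walkKernel G) 0 (fun _ => x)

/-- The hitting time `inf {t ≥ 0 : X t ∈ Z}`, equal to `∞` if `Z` is never hit. -/
def hittingTime (Z : Set V) (X : ℕ → V) : ℕ∞ :=
  sInf ((fun t : ℕ => (t : ℕ∞)) '' {t | X t ∈ Z})

/-- The Green function `G_Z(x, y) = E_x (∑_{t < τ_Z} 1{X t = y})`, with values in `[0, ∞]`. -/
def green (G : SimpleGraph V) [G.LocallyFinite] [MeasurableSpace V]
    [DiscreteMeasurableSpace V] (Z : Set V) (x y : V) : ℝ≥0∞ :=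
  open Classical in
  ∫⁻ X, ∑' t : ℕ, (if (t : ℕ∞) < hittingTime Z X ∧ X t = y then 1 else 0) ∂(walkLaw G x)

/-! ### Configurations, instructions and topplings -/

/-- The state of a vertex: one sleeping particle (`ρ`), or `n` active particles. -/
inductive SiteState where
  | sleeping : SiteState
  | active (n : ℕ) : SiteState

/-- A vertex is unstable if it carries at least one active particle. -/
def SiteState.Unstable : SiteState → Prop
  | .sleeping => False
  | .active n => 1 ≤ n

/-- Remove one active particle (no effect if there is none). -/
def SiteState.remove : SiteState → SiteState
  | .sleeping => .sleeping
  | .active n => .active (n - 1)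

/-- Add one active particle; it wakes up a sleeping particle (`1 + ρ = 2`). -/
def SiteState.add : SiteState → SiteState
  | .sleeping => .active 2
  | .active n => .active (n + 1)

/-- Try to fall asleep: this succeeds only for a lone active particle. -/
def SiteState.fallAsleep : SiteState → SiteState
  | .sleeping => .sleeping
  | .active n => if n = 1 then .sleeping else .active n

/-- Instructions attached to a vertex: "fall asleep", or "jump to the vertex `y`". -/
inductive Instr (V : Type*) where
  | sleep : Instr V
  | jump (y : V) : Instr V

instance : MeasurableSpace (Instr V) := ⊤

instance : DiscreteMeasurableSpace (Instr V) := ⟨fun _ => trivial⟩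

/-- The configuration obtained from `η` by performing an instruction attached to `x`. -/
def Instr.perform (x : V) : Instr V → (V → SiteState) → (V → SiteState)
  | .sleep, η => open Classical in Function.update η x (η x).fallAsleep
  | .jump y, η => open Classical in
      if (η x).Unstable then
        Function.update (Function.update η x (η x).remove) y
          ((Function.update η x (η x).remove) y).add
      else η

/-- Topple `x`: the first instruction at `x` that has not yet been used is performed.
The second component of the state counts the instructions already used at each vertex,
and `τ (x, j)` is the instruction at `x` that is used after `j` others have been. -/
def topple (τ : V × ℕ → Instr V) (x : V) (s : (V → SiteState) × (V → ℕ)) :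
    (V → SiteState) × (V → ℕ) :=
  open Classical in
  ((τ (x, s.2 x)).perform x s.1, Function.update s.2 x (s.2 x + 1))

/-- Topple the vertices of a list one after the other, from left to right. -/
def toppleList (τ : V × ℕ → Instr V) :
    List V → (V → SiteState) × (V → ℕ) → (V → SiteState) × (V → ℕ)
  | [], s => s
  | x :: α, s => toppleList τ α (topple τ x s)

/-- Every toppling of the list is legal: it is performed at a vertex that is then unstable. -/
def IsLegal (τ : V × ℕ → Instr V) : List V → (V → SiteState) × (V → ℕ) → Prop
  | [], _ => True
  | x :: α, s => (s.1 x).Unstable ∧ IsLegal τ α (topple τ x s)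

/-- `η'` is the configuration reached from `η` by stabilizing `K` with the instructions `τ`: it is
the result of a finite legal sequence of topplings of vertices of `K`, and all the vertices of `K`
are stable in it. (It does not depend on the sequence, by the abelian property.) -/
def IsStabilization (τ : V × ℕ → Instr V) (K : Finset V) (η η' : V → SiteState) : Prop :=
  ∃ α : List V, (∀ y ∈ α, y ∈ K) ∧ IsLegal τ α (η, fun _ => 0) ∧
    (toppleList τ α (η, fun _ => 0)).1 = η' ∧ ∀ y ∈ K, ¬ (η' y).Unstable

/-! ### The probability measure and `Q(x, K)` -/

/-- The law of an instruction at `x`: "sleep" with probability `lam / (1 + lam)`, and otherwise,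
with probability `1 / (1 + lam)`, a jump to a uniformly chosen neighbour of `x`. -/
def instrLaw (G : SimpleGraph V) [G.LocallyFinite] [MeasurableSpace V]
    [DiscreteMeasurableSpace V] (lam : ℝ) (x : V) : Measure (Instr V) :=
  ENNReal.ofReal (lam / (1 + lam)) • Measure.dirac Instr.sleep +
    ENNReal.ofReal (1 / (1 + lam)) • (stepLaw G x).toMeasure.map Instr.jump

/-- For a positive sleeping rate, `instrLaw` is a probability measure. -/
theorem isProbabilityMeasure_instrLaw (G : SimpleGraph V) [G.LocallyFinite] [MeasurableSpace V]
    [DiscreteMeasurableSpace V] {lam : ℝ} (hlam : 0 < lam) (x : V) :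
    IsProbabilityMeasure (instrLaw G lam x) := by
  constructor
  have h : (stepLaw G x).toMeasure.map Instr.jump Set.univ = 1 := by
    rw [Measure.map_apply Measurable.of_discrete MeasurableSet.univ]
    simp
  simp only [instrLaw, Measure.add_apply, Measure.smul_apply, h, measure_univ, smul_eq_mul, mul_one]
  rw [← ENNReal.ofReal_add (by positivity) (by positivity), ← ENNReal.ofReal_one]
  congr 1
  field_simp
  ring

/-- The joint law of the initial numbers of particles (independent Poisson variables of mean `mu`)
and of the instructions (independent of each other and of the numbers of particles). -/
def jointLaw (G : SimpleGraph V) [G.LocallyFinite] [MeasurableSpace V]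
    [DiscreteMeasurableSpace V] (lam : ℝ) (mu : ℝ≥0) :
    Measure ((V → ℕ) × (V × ℕ → Instr V)) :=
  (Measure.infinitePi fun _ : V => poissonMeasure mu).prod
    (Measure.infinitePi fun p : V × ℕ => instrLaw G lam p.1)

/-- `Q(x, K)`: the probability that `x` hosts a sleeping particle after the stabilization of `K`,
all the particles being active at the beginning. -/
def Q (G : SimpleGraph V) [G.LocallyFinite] [MeasurableSpace V]
    [DiscreteMeasurableSpace V] (lam : ℝ) (mu : ℝ≥0) (x : V) (K : Finset V) : ℝ≥0∞ :=
  jointLaw G lam mu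
    {ω | ∃ η', IsStabilization ω.2 K (fun v => SiteState.active (ω.1 v)) η' ∧
      η' x = SiteState.sleeping}

end ARW

end

/-! Write `p = 1/(1+λ)` and `s = λ/(1+λ)`. Call a stabilization weak if it never topples `x` while
`x` carries a lone particle. When it stops, either `x` is empty and `K` is stable, or `x` carries
exactly one active particle and the rest of `K` is stable. In the second case topple `x`: on "sleep"
bound the probability of ending asleep by 1, on "jump" resume with `x` emptied. If `N` counts the
jumps needed until `x` stays empty, then `x` ends asleep with probability at most `1 - E p^N ≤ 1 -
p^H P(N ≤ H)`, and Markov's inequality gives `P(N > H) ≤ E N/(H+1)`.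

To control `E N`, run the same topplings with one more particle at `x`. There `x` carries a pair
whenever the original has a lone particle, so "sleep" has no effect and the toppling is weakly
legal: `N` is the number of additional jumps from `x` caused by the additional particle. The value
`weakValSup` is the expected number of jumps (`p` times the expected number of topplings of `x`),
and `sleeping_bound` proves the estimate by induction on such expectations, without constructing
`N`.

Moving the additional particle by force before everything else cannot lower the expected number of
jumps (`weakVal_le_hop`). Hence the excess, as a function of the particle's position, is subharmonic
up to a unit source at `x`, and the maximum principle `le_killedSum` bounds it at `x` by the Green
function. When the latter is finite so is `weakValSup` (`weakValSup_ne_top`), which allows the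
common term to be cancelled.

The stacks enter only through a one-step inequality: by the abelian property any unstable vertex of
`K` may be toppled first (`AsleepWithin.step`), and conditioning on its first instruction leaves
fresh independent stacks (`infinitePi_le_sum_first`). -/

noncomputable section

namespace ARW

variable {V : Type*}

/-! ### Elementary operations on configurations -/

/-- A vertex is occupied if it carries a particle, active or sleeping. -/
def SiteState.Occupied : SiteState → Prop
  | .sleeping => True
  | .active n => 1 ≤ n

/-- Remove one particle, active or sleeping. -/
def SiteState.pop : SiteState → SiteState
  | .sleeping => .active 0
  | .active n => .active (n - 1)

theorem SiteState.Unstable.occupied {a : SiteState} (h : a.Unstable) : a.Occupied := by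
  cases a with
  | sleeping => trivial
  | active n => exact h

theorem SiteState.Unstable.add {a : SiteState} (h : a.Unstable) : a.add.Unstable := by
  cases a with
  | sleeping => exact h.elim
  | active n => exact Nat.le_add_left 1 n

theorem SiteState.Occupied.add {a : SiteState} (h : a.Occupied) : a.add.Occupied := by
  cases a with
  | sleeping => exact Nat.le_succ 1
  | active n => exact Nat.le_add_left 1 n

theorem SiteState.Unstable.remove_eq_pop {a : SiteState} (h : a.Unstable) : a.remove = a.pop := by
  cases a with
  | sleeping => exact h.elim
  | active n => rfl

theorem SiteState.Occupied.pop_add {a : SiteState} (h : a.Occupied) : a.add.pop = a.pop.add := by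
  cases a with
  | sleeping => rfl
  | active n =>
    change 1 ≤ n at h
    simp only [SiteState.add, SiteState.pop, SiteState.active.injEq]
    omega

/-- A lone particle that falls asleep is woken by the newcomer, and on two or more particles "sleep"
has no effect. Hence "sleep" commutes with arrivals. -/
theorem SiteState.Unstable.fallAsleep_add {a : SiteState} (h : a.Unstable) :
    a.add.fallAsleep = a.fallAsleep.add := by
  cases a with
  | sleeping => exact h.elim
  | active n =>
    change 1 ≤ n at h
    by_cases h1 : n = 1
    · subst h1
      simp [SiteState.add, SiteState.fallAsleep]
    · have : n + 1 ≠ 1 := by omega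
      simp [SiteState.add, SiteState.fallAsleep, h1]
      omega

theorem SiteState.Unstable.pop_fallAsleep {a : SiteState} (h : a.Unstable) :
    a.fallAsleep.pop = a.pop := by
  cases a with
  | sleeping => exact h.elim
  | active n =>
    by_cases h1 : n = 1 <;> simp [SiteState.fallAsleep, SiteState.pop, h1]

theorem SiteState.Unstable.occupied_fallAsleep {a : SiteState} (h : a.Unstable) :
    a.fallAsleep.Occupied := by
  cases a with
  | sleeping => exact h.elim
  | active n =>
    by_cases h1 : n = 1
    · simp [SiteState.fallAsleep, h1, SiteState.Occupied]
    · simp only [SiteState.fallAsleep, h1, if_false]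
      exact h

/-- Add an active particle at `x`. -/
def addAt (x : V) (η : V → SiteState) : V → SiteState :=
  open Classical in fun v => if v = x then (η v).add else η v

/-- Move a particle from `y` to `w`, ignoring whether it sleeps. -/
def hop (y w : V) (η : V → SiteState) : V → SiteState :=
  open Classical in addAt w fun v => if v = y then (η v).pop else η v

theorem perform_sleep_apply (y : V) (η : V → SiteState) (v : V) :
    open Classical in (Instr.sleep : Instr V).perform y η v =
      if v = y then (η v).fallAsleep else η v := by
  classical
  by_cases h : v = y
  · subst h; simp [Instr.perform]
  · simp [Instr.perform, h]

theorem perform_jump {y : V} {η : V → SiteState} (h : (η y).Unstable) (w : V) :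
    (Instr.jump w : Instr V).perform y η = hop y w η := by
  classical
  funext v
  simp only [Instr.perform, if_pos h, hop, addAt, h.remove_eq_pop]
  by_cases hw : v = w
  · subst hw
    by_cases hy : v = y
    · subst hy; simp
    · simp [hy]
  · by_cases hy : v = y
    · subst hy; simp [hw]
    · simp [hy, hw]

theorem hop_hop {y z : V} (hyz : y ≠ z) {η : V → SiteState} (hy : (η y).Occupied)
    (hz : (η z).Occupied) (w u : V) : hop y w (hop z u η) = hop z u (hop y w η) := by
  funext v
  have hy' := hy.pop_add
  have hz' := hz.pop_add
  simp only [hop, addAt]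
  grind

theorem hop_sleep {y z : V} (hyz : y ≠ z) {η : V → SiteState}
    (hz : (η z).Unstable) (w : V) :
    hop y w (Instr.sleep.perform z η) = Instr.sleep.perform z (hop y w η) := by
  funext v
  have hz' := hz.fallAsleep_add
  simp only [hop, addAt, perform_sleep_apply]
  grind

/-- A forced move carries off a sleeping particle like an active one, so having fallen asleep leaves
no trace. -/
theorem hop_sleep_self {y : V} {η : V → SiteState} (h : (η y).Unstable) (w : V) :
    hop y w (Instr.sleep.perform y η) = hop y w η := by
  funext v
  simp only [hop, addAt, perform_sleep_apply]
  by_cases h1 : v = y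
  · subst h1
    simp [h.pop_fallAsleep]
  · simp [h1]

theorem sleep_sleep {y z : V} (hyz : y ≠ z) (η : V → SiteState) :
    (Instr.sleep : Instr V).perform y ((Instr.sleep : Instr V).perform z η) =
      (Instr.sleep : Instr V).perform z ((Instr.sleep : Instr V).perform y η) := by
  funext v
  simp only [perform_sleep_apply]
  by_cases h1 : v = y
  · subst h1; simp [hyz]
  · simp [h1]

theorem perform_of_ne {y v : V} (hv : v ≠ y) (i : Instr V) (η : V → SiteState) :
    i.perform y η v = η v ∨ i.perform y η v = (η v).add := by
  cases i with
  | sleep => left; simp [perform_sleep_apply, hv]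
  | jump w =>
    by_cases h : (η y).Unstable
    · rw [perform_jump h]
      simp only [hop, addAt]
      grind
    · left; simp [Instr.perform, h]

theorem unstable_perform {y z : V} (h : z ≠ y) (i : Instr V) {η : V → SiteState}
    (hz : (η z).Unstable) : (i.perform y η z).Unstable := by
  rcases perform_of_ne h i η with e | e <;> rw [e]
  exacts [hz, hz.add]

theorem occupied_perform {y z : V} (h : z ≠ y) (i : Instr V) {η : V → SiteState}
    (hz : (η z).Occupied) : (i.perform y η z).Occupied := by
  rcases perform_of_ne h i η with e | e <;> rw [e]
  exacts [hz, hz.add]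

theorem unstable_hop {y z : V} (h : z ≠ y) (w : V) {η : V → SiteState}
    (hz : (η z).Unstable) : (hop y w η z).Unstable := by
  by_cases hw : z = w
  · subst hw; simpa [hop, addAt, h] using hz.add
  · simpa [hop, addAt, h, hw] using hz

theorem hop_perform {y z : V} (hyz : y ≠ z) {η : V → SiteState} (hy : (η y).Occupied)
    (hz : (η z).Unstable) (w : V) (i : Instr V) :
    hop y w (i.perform z η) = i.perform z (hop y w η) := by
  cases i with
  | sleep => exact hop_sleep hyz hz w
  | jump u =>
    rw [perform_jump hz, perform_jump (unstable_hop hyz.symm w hz)]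
    exact hop_hop hyz hy hz.occupied w u

/-- Topplings of distinct unstable vertices commute. -/
theorem perform_perform {y z : V} (hyz : y ≠ z) {η : V → SiteState} (hy : (η y).Unstable)
    (hz : (η z).Unstable) (i j : Instr V) :
    j.perform y (i.perform z η) = i.perform z (j.perform y η) := by
  cases j with
  | jump w =>
    rw [perform_jump (unstable_perform hyz i hy), perform_jump hy]
    exact hop_perform hyz hy.occupied hz w i
  | sleep =>
    cases i with
    | sleep => exact sleep_sleep hyz η
    | jump u =>
      rw [perform_jump hz, perform_jump (unstable_perform hyz.symm _ hz)]
      exact (hop_sleep hyz.symm hy u).symm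

theorem perform_congr {K : Finset V} {y : V} (hy : y ∈ K) (i : Instr V) {η ζ : V → SiteState}
    (h : ∀ v ∈ K, η v = ζ v) : ∀ v ∈ K, i.perform y η v = i.perform y ζ v := by
  intro v hv
  cases i with
  | sleep => simp only [perform_sleep_apply, h v hv]
  | jump w =>
    by_cases hu : (η y).Unstable
    · rw [perform_jump hu, perform_jump (h y hy ▸ hu)]
      simp only [hop, addAt, h v hv]
    · have hu' : ¬ (ζ y).Unstable := h y hy ▸ hu
      simp only [Instr.perform, if_neg hu, if_neg hu', h v hv]

/-- This couples the evolutions with and without the additional particle, both reading the same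
instruction. -/
theorem addAt_perform {x y : V} {η : V → SiteState} (hy : (η y).Unstable) (i : Instr V) :
    addAt x (i.perform y η) = i.perform y (addAt x η) := by
  have hy' : (addAt x η y).Unstable := by
    by_cases hx : y = x
    · subst hx; simpa [addAt] using hy.add
    · simpa [addAt, hx] using hy
  have h1 := hy.occupied.pop_add
  have h2 := hy.fallAsleep_add
  funext v
  cases i with
  | sleep =>
    simp only [addAt, perform_sleep_apply]
    grind
  | jump w =>
    rw [perform_jump hy, perform_jump hy']
    simp only [hop, addAt]
    grind

/-! ### Averages over neighbours and over instructions -/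

/-- The mean of `f` over the neighbours of `y`. -/
def nbrMean (G : SimpleGraph V) [G.LocallyFinite] (y : V) (f : V → ℝ≥0∞) : ℝ≥0∞ :=
  ∑ w ∈ G.neighborFinset y, (G.degree y : ℝ≥0∞)⁻¹ * f w

/-- The instructions that may occur at `y`. -/
def instrs (G : SimpleGraph V) [G.LocallyFinite] (y : V) : Finset (Instr V) :=
  open Classical in insert Instr.sleep ((G.neighborFinset y).image Instr.jump)

/-- The weight of an instruction at `y`, for a sleeping probability `s` and a jumping
probability `p`. -/
def wt (G : SimpleGraph V) [G.LocallyFinite] (s p : ℝ≥0∞) (y : V) : Instr V → ℝ≥0∞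
  | .sleep => s
  | .jump _ => p * (G.degree y : ℝ≥0∞)⁻¹

/-- The mean of `f` over the instructions at `y`. -/
def avg (G : SimpleGraph V) [G.LocallyFinite] (s p : ℝ≥0∞) (y : V) (f : Instr V → ℝ≥0∞) :
    ℝ≥0∞ :=
  ∑ i ∈ instrs G y, wt G s p y i * f i

section Averages

variable {G : SimpleGraph V} [G.LocallyFinite] {s p : ℝ≥0∞} {y z : V}

theorem avg_eq (f : Instr V → ℝ≥0∞) :
    avg G s p y f = s * f .sleep + p * nbrMean G y fun w => f (.jump w) := by
  classical
  have h1 : (Instr.sleep : Instr V) ∉ (G.neighborFinset y).image Instr.jump := by simp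
  have h2 : Function.Injective (Instr.jump : V → Instr V) := fun a b h => by injection h
  unfold avg instrs nbrMean
  rw [Finset.sum_insert (by convert h1), Finset.sum_image h2.injOn, Finset.mul_sum]
  simp only [wt, mul_assoc]

theorem nbrMean_mono {f g : V → ℝ≥0∞} (h : ∀ w, f w ≤ g w) : nbrMean G y f ≤ nbrMean G y g :=
  Finset.sum_le_sum fun w _ => by gcongr; exact h w

theorem nbrMean_add (f g : V → ℝ≥0∞) :
    nbrMean G y (fun w => f w + g w) = nbrMean G y f + nbrMean G y g := by
  simp only [nbrMean, mul_add, Finset.sum_add_distrib]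

theorem nbrMean_mul (c : ℝ≥0∞) (f : V → ℝ≥0∞) :
    nbrMean G y (fun w => c * f w) = c * nbrMean G y f := by
  simp only [nbrMean, Finset.mul_sum, mul_left_comm]

theorem nbrMean_const (hy : 0 < G.degree y) (c : ℝ≥0∞) : nbrMean G y (fun _ => c) = c := by
  simp only [nbrMean, Finset.sum_const, SimpleGraph.card_neighborFinset_eq_degree, nsmul_eq_mul]
  rw [← mul_assoc, ENNReal.mul_inv_cancel (by exact_mod_cast hy.ne') (by simp), one_mul]

theorem avg_mono {f g : Instr V → ℝ≥0∞} (h : ∀ i, f i ≤ g i) :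
    avg G s p y f ≤ avg G s p y g :=
  Finset.sum_le_sum fun i _ => by gcongr; exact h i

theorem avg_add (f g : Instr V → ℝ≥0∞) :
    avg G s p y (fun i => f i + g i) = avg G s p y f + avg G s p y g := by
  simp only [avg, mul_add, Finset.sum_add_distrib]

theorem avg_mul (c : ℝ≥0∞) (f : Instr V → ℝ≥0∞) :
    avg G s p y (fun i => c * f i) = c * avg G s p y f := by
  simp only [avg, Finset.mul_sum, mul_left_comm]

theorem avg_const (hsp : s + p = 1) (hy : 0 < G.degree y) (c : ℝ≥0∞) :
    avg G s p y (fun _ => c) = c := by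
  rw [avg_eq, nbrMean_const hy, ← add_mul, hsp, one_mul]

theorem nbrMean_const_add (hy : 0 < G.degree y) (c : ℝ≥0∞) (f : V → ℝ≥0∞) :
    nbrMean G y (fun w => c + f w) = c + nbrMean G y f := by
  rw [nbrMean_add, nbrMean_const hy]

theorem avg_const_add (hsp : s + p = 1) (hy : 0 < G.degree y) (c : ℝ≥0∞) (f : Instr V → ℝ≥0∞) :
    avg G s p y (fun i => c + f i) = c + avg G s p y f := by
  rw [avg_add, avg_const hsp hy]

theorem avg_comm (f : Instr V → Instr V → ℝ≥0∞) :
    avg G s p y (fun j => avg G s p z fun i => f i j) =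
      avg G s p z fun i => avg G s p y fun j => f i j := by
  simp only [avg, Finset.mul_sum]
  rw [Finset.sum_comm]
  simp only [mul_left_comm]

theorem avg_nbrMean_comm (f : Instr V → V → ℝ≥0∞) :
    avg G s p y (fun i => nbrMean G z (f i)) = nbrMean G z fun w => avg G s p y fun i => f i w := by
  simp only [avg, nbrMean, Finset.mul_sum]
  rw [Finset.sum_comm]
  simp only [mul_left_comm]

theorem avg_iSup {f : ℕ → Instr V → ℝ≥0∞} (hf : Monotone f) :
    avg G s p y (fun i => ⨆ k, f k i) = ⨆ k, avg G s p y (f k) := by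
  simp only [avg, ENNReal.mul_iSup]
  exact ENNReal.finsetSum_iSup_of_monotone fun i a b h => by gcongr; exact hf h i

end Averages

/-! ### Expected numbers of topplings in the weak stabilization -/

/-- Toppling `y` is weakly legal if `y` is an unstable vertex of `K` and, in case `y = x`,
carries at least two particles. -/
def WeakLegal (K : Finset V) (x y : V) (η : V → SiteState) : Prop :=
  y ∈ K ∧ (η y).Unstable ∧ (y = x → ∃ n, η x = .active (n + 2))

/-- The weight of a toppling of `y`. -/
def cost (p : ℝ≥0∞) (x y : V) : ℝ≥0∞ :=
  open Classical in if y = x then p else 0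

/-- The supremum, over the strategies of at most `k` weakly legal topplings, of `p` times the
expected number of topplings of `x`. -/
def weakVal (G : SimpleGraph V) [G.LocallyFinite] (s p : ℝ≥0∞) (K : Finset V) (x : V) :
    ℕ → (V → SiteState) → ℝ≥0∞
  | 0, _ => 0
  | k + 1, η => ⨆ (y : V) (_ : WeakLegal K x y η),
      cost p x y + avg G s p y fun i => weakVal G s p K x k (i.perform y η)

/-- The supremum of `weakVal` over the numbers of topplings. -/
def weakValSup (G : SimpleGraph V) [G.LocallyFinite] (s p : ℝ≥0∞) (K : Finset V) (x : V)
    (η : V → SiteState) : ℝ≥0∞ :=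
  ⨆ k, weakVal G s p K x k η

section WeakVal

variable {G : SimpleGraph V} [G.LocallyFinite] {s p : ℝ≥0∞} {K : Finset V} {x y z : V}
  {η : V → SiteState}

/-- A toppling elsewhere can only bring particles to `z`. -/
theorem WeakLegal.perform (h : WeakLegal K x z η) (hzy : z ≠ y) (i : Instr V) :
    WeakLegal K x z (i.perform y η) := by
  refine ⟨h.1, unstable_perform hzy i h.2.1, fun hz => ?_⟩
  obtain ⟨n, hn⟩ := h.2.2 hz
  subst hz
  rcases perform_of_ne hzy i η with e | e <;> rw [e, hn]
  exacts [⟨n, rfl⟩, ⟨n + 1, rfl⟩]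

theorem WeakLegal.hop (h : WeakLegal K x z η) (hzy : z ≠ y) (w : V) :
    WeakLegal K x z (hop y w η) := by
  refine ⟨h.1, unstable_hop hzy w h.2.1, fun hz => ?_⟩
  obtain ⟨n, hn⟩ := h.2.2 hz
  subst hz
  by_cases hw : z = w
  · exact ⟨n + 1, by simp [ARW.hop, addAt, hzy, ← hw, hn, SiteState.add]⟩
  · exact ⟨n, by simp [ARW.hop, addAt, hzy, hw, hn]⟩

theorem WeakLegal.addAt (h : WeakLegal K x y η) : WeakLegal K x y (addAt x η) := by
  by_cases hx : y = x
  · subst hx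
    obtain ⟨n, hn⟩ := h.2.2 rfl
    refine ⟨h.1, by simpa [ARW.addAt] using h.2.1.add, fun _ => ⟨n + 1, ?_⟩⟩
    simp [ARW.addAt, hn, SiteState.add]
  · exact ⟨h.1, by simpa [ARW.addAt, hx] using h.2.1, fun h => (hx h).elim⟩

theorem weakVal_mono_succ (k : ℕ) (η : V → SiteState) :
    weakVal G s p K x k η ≤ weakVal G s p K x (k + 1) η := by
  induction k generalizing η with
  | zero => exact zero_le
  | succ k ih =>
    refine iSup₂_le fun y hy => le_iSup₂_of_le y hy ?_
    gcongr
    exact avg_mono fun i => ih _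

theorem weakVal_mono : Monotone (weakVal G s p K x) :=
  monotone_nat_of_le_succ fun k η => weakVal_mono_succ k η

theorem le_weakVal_succ (hy : WeakLegal K x y η) (k : ℕ) :
    cost p x y + avg G s p y (fun i => weakVal G s p K x k (i.perform y η)) ≤
      weakVal G s p K x (k + 1) η :=
  le_iSup₂_of_le y hy le_rfl

theorem le_weakValSup (hy : WeakLegal K x y η) :
    cost p x y + avg G s p y (fun i => weakValSup G s p K x (i.perform y η)) ≤
      weakValSup G s p K x η := by
  unfold weakValSup
  rw [avg_iSup (f := fun k i => weakVal G s p K x k (i.perform y η))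
    fun a b h i => weakVal_mono h _, ENNReal.add_iSup]
  exact iSup_le fun k => (le_weakVal_succ hy k).trans (le_iSup_of_le (k + 1) le_rfl)

/-- Least action: starting with `y` loses nothing. If a strategy starts with `z ≠ y`, each of the
two topplings stays weakly legal after the other and they commute, so `y` can be brought to the
front. -/
theorem weakVal_le_of_weakLegal (hsp : s + p = 1) (hG : ∀ v, 0 < G.degree v) (k : ℕ)
    (hy : WeakLegal K x y η) :
    weakVal G s p K x k η ≤
      cost p x y + avg G s p y fun i => weakVal G s p K x k (i.perform y η) := by
  induction k generalizing η with
  | zero => exact zero_le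
  | succ k ih =>
    refine iSup₂_le fun z hz => ?_
    by_cases hyz : y = z
    · subst hyz
      gcongr
      exact avg_mono fun i => weakVal_mono_succ k _
    calc cost p x z + avg G s p z (fun i => weakVal G s p K x k (i.perform z η))
        ≤ cost p x z + avg G s p z (fun i => cost p x y +
            avg G s p y fun j => weakVal G s p K x k (j.perform y (i.perform z η))) := by
          gcongr
          exact avg_mono fun i => ih (hy.perform hyz i)
      _ = cost p x y + avg G s p y (fun j => cost p x z +
            avg G s p z fun i => weakVal G s p K x k (i.perform z (j.perform y η))) := by
          rw [avg_const_add hsp (hG z), avg_const_add hsp (hG y), add_left_comm, avg_comm]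
          simp only [perform_perform hyz hy.2.1 hz.2.1]
      _ ≤ _ := by
          gcongr
          exact avg_mono fun j => le_weakVal_succ (hz.perform (Ne.symm hyz) j) k

theorem weakValSup_le (hsp : s + p = 1) (hG : ∀ v, 0 < G.degree v) (hy : WeakLegal K x y η) :
    weakValSup G s p K x η ≤
      cost p x y + avg G s p y fun i => weakValSup G s p K x (i.perform y η) := by
  refine iSup_le fun k => (weakVal_le_of_weakLegal hsp hG k hy).trans ?_
  gcongr
  exact avg_mono fun i => le_iSup (fun k => weakVal G s p K x k (i.perform y η)) k

/-- Moving a particle of `y` by force, before the weak stabilization, does not decrease the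
number of topplings. -/
theorem weakVal_le_hop (hsp : s + p = 1) (hG : ∀ v, 0 < G.degree v) (k : ℕ)
    (hy : (η y).Occupied) :
    weakVal G s p K x k η ≤
      cost 1 x y + nbrMean G y fun w => weakVal G s p K x k (hop y w η) := by
  induction k generalizing η with
  | zero => exact zero_le
  | succ k ih =>
    refine iSup₂_le fun z hz => ?_
    by_cases hyz : y = z
    · subst hyz
      -- A toppling of `y` either reads "sleep", and the forced move is still to be made, or jumps,
      -- which is the forced move itself. Repeating it until the first jump costs `p/(1-s) = 1` when
      -- `y = x`, whence the constant 1 in `cost 1 x y`.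
      have hcost : cost p x y + s * cost 1 x y = cost 1 x y := by
        unfold cost; split_ifs
        · rw [mul_one, add_comm, hsp]
        · simp
      have hocc : ((Instr.sleep : Instr V).perform y η y).Occupied := by
        simpa [perform_sleep_apply] using hz.2.1.occupied_fallAsleep
      have h := ih hocc
      simp only [hop_sleep_self hz.2.1] at h
      rw [avg_eq]
      simp only [perform_jump hz.2.1]
      calc _ ≤ cost p x y + (s * (cost 1 x y +
              nbrMean G y fun w => weakVal G s p K x k (ARW.hop y w η)) +
              p * nbrMean G y fun w => weakVal G s p K x k (ARW.hop y w η)) := by gcongr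
        _ = (cost p x y + s * cost 1 x y) +
              (s + p) * nbrMean G y fun w => weakVal G s p K x k (ARW.hop y w η) := by ring
        _ ≤ _ := by
          rw [hcost, hsp, one_mul]
          gcongr
          exact nbrMean_mono fun w => weakVal_mono_succ k _
    calc cost p x z + avg G s p z (fun i => weakVal G s p K x k (i.perform z η))
        ≤ cost p x z + avg G s p z (fun i => cost 1 x y +
            nbrMean G y fun w => weakVal G s p K x k (ARW.hop y w (i.perform z η))) := by
          gcongr
          exact avg_mono fun i => ih (occupied_perform hyz i hy)
      _ = cost 1 x y + nbrMean G y (fun w => cost p x z +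
            avg G s p z fun i => weakVal G s p K x k (i.perform z (ARW.hop y w η))) := by
          rw [avg_const_add hsp (hG z), nbrMean_const_add (hG y), add_left_comm,
            avg_nbrMean_comm]
          simp only [hop_perform hyz hy hz.2.1]
      _ ≤ _ := by
          gcongr
          exact nbrMean_mono fun w => le_weakVal_succ (hz.hop (Ne.symm hyz) w) k

/-- Supplies the boundedness that the maximum principle requires. -/
theorem weakVal_le_natCast (hsp : s + p = 1) (hG : ∀ v, 0 < G.degree v) (k : ℕ)
    (η : V → SiteState) : weakVal G s p K x k η ≤ k := by
  induction k generalizing η with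
  | zero => exact zero_le
  | succ k ih =>
    refine iSup₂_le fun y _ => ?_
    have h1 : cost p x y ≤ 1 := by
      unfold cost; split_ifs
      exacts [hsp ▸ le_add_self, zero_le]
    calc _ ≤ 1 + avg G s p y (fun _ => (k : ℝ≥0∞)) := add_le_add h1 (avg_mono fun i => ih _)
      _ = _ := by rw [avg_const hsp (hG y), add_comm]; push_cast; rfl

/-- The weak stabilization only depends on the configuration in `K`. -/
theorem weakVal_congr (k : ℕ) {η ζ : V → SiteState} (h : ∀ v ∈ K, η v = ζ v) (hx : x ∈ K) :
    weakVal G s p K x k η = weakVal G s p K x k ζ := by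
  induction k generalizing η ζ with
  | zero => rfl
  | succ k ih =>
    have hl : ∀ y, WeakLegal K x y η ↔ WeakLegal K x y ζ := fun y => by
      unfold WeakLegal
      refine and_congr_right fun hy => ?_
      rw [h y hy, h x hx]
    simp only [weakVal, hl]
    refine iSup_congr fun y => iSup_congr fun hy => ?_
    congr 2
    funext i
    exact ih (perform_congr hy.1 i h)

theorem weakValSup_eq_zero (h : ∀ y, ¬ WeakLegal K x y η) : weakValSup G s p K x η = 0 := by
  refine le_antisymm (iSup_le fun k => ?_) zero_le
  cases k with
  | zero => exact zero_le
  | succ k => exact iSup₂_le fun y hy => (h y hy).elim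

end WeakVal

section WeakVal

variable {G : SimpleGraph V} [G.LocallyFinite] {s p : ℝ≥0∞} {K : Finset V} {x y z : V}
  {η : V → SiteState}

/-- Every weakly legal toppling remains so when `x` receives one more particle. -/
theorem weakVal_le_addAt (k : ℕ) (η : V → SiteState) :
    weakVal G s p K x k η ≤ weakVal G s p K x k (addAt x η) := by
  induction k generalizing η with
  | zero => exact le_rfl
  | succ k ih =>
    refine iSup₂_le fun y hy => le_trans ?_ (le_weakVal_succ hy.addAt k)
    gcongr
    refine avg_mono fun i => ?_
    rw [← addAt_perform hy.2.1]
    exact ih _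

theorem weakValSup_le_addAt (η : V → SiteState) :
    weakValSup G s p K x η ≤ weakValSup G s p K x (addAt x η) :=
  iSup_mono fun k => weakVal_le_addAt k η

theorem WeakLegal.perform_ne_sleeping (hy : WeakLegal K x y η) (hx : η x ≠ .sleeping)
    (i : Instr V) : i.perform y η x ≠ .sleeping := by
  have hadd : ∀ a : SiteState, a.add ≠ .sleeping := fun a => by cases a <;> simp [SiteState.add]
  by_cases hyx : x = y
  · subst hyx
    obtain ⟨n, hn⟩ := hy.2.2 rfl
    cases i with
    | sleep => simp [perform_sleep_apply, hn, SiteState.fallAsleep]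
    | jump w =>
      rw [perform_jump hy.2.1]
      simp only [ARW.hop, ARW.addAt, hn, SiteState.pop]
      grind
  · rcases perform_of_ne hyx i η with e | e <;> rw [e]
    exacts [hx, hadd _]

end WeakVal

/-! ### Markov's inequality by induction: the probability of a sleeping particle at `x` -/

/-- One toppling of a lone particle at `x`. Here `q` and `E` bound the probability of ending asleep
before the toppling and after a jump; `X` and `F` are the expected jumps with the additional
particle, before and after that jump. -/
theorem markov_step {s p q X E F : ℝ} {h : ℕ} (hsp : s + p = 1) (hp : 0 < p)
    (hq1 : q ≤ 1) (hq : q ≤ s + p * E)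
    (hE : (h + 1) * (E + p ^ h) ≤ (h + 1) + p ^ h * F) (hX : p + s * X + p * F ≤ X) :
    (h + 2) * (q + p ^ (h + 1)) ≤ (h + 2) + p ^ (h + 1) * X := by
  have hX' : 1 + F ≤ X := by
    have : p * (1 + F) ≤ p * X := by
      have : s = 1 - p := by linarith
      subst this; linarith
    exact le_of_mul_le_mul_left this hp
  have hP : 0 < p ^ h := pow_pos hp h
  have hh : (0 : ℝ) ≤ h := Nat.cast_nonneg h
  -- For `X` this large the claim already follows from `q ≤ 1`.
  by_cases hbig : (h : ℝ) + 2 ≤ X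
  · have h1 : p ^ (h + 1) * (h + 2) ≤ p ^ (h + 1) * X := by gcongr
    nlinarith
  · push Not at hbig
    set P := p ^ h
    have e : p ^ (h + 1) = p * P := by rw [pow_succ, mul_comm]
    rw [e]
    have h1 : (h + 1) * (q + p * P) ≤ (h + 1) + p * P * (X - 1) := by
      have h2 : (h + 1) * q ≤ (h + 1) * (s + p * E) := by gcongr
      have h3 : p * ((h + 1) * (E + P)) ≤ p * ((h + 1) + P * F) := by gcongr
      have h4 : p * P * F ≤ p * P * (X - 1) := by
        have : F ≤ X - 1 := by linarith
        gcongr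
      have h5 : (h + 1 : ℝ) * s + (h + 1) * p = h + 1 := by rw [← mul_add, hsp, mul_one]
      linarith
    -- Amounts to `(X - 1)/(h + 1) ≤ X/(h + 2)`, which holds exactly when `X ≤ h + 2`.
    have h6 : (h + 1) * (h + 2) * (q + p * P) ≤ (h + 1) * ((h + 2) + p * P * X) := by
      have h7 : (h + 2) * ((h + 1) * (q + p * P)) ≤ (h + 2) * ((h + 1) + p * P * (X - 1)) := by
        gcongr
      have h8 : 0 ≤ p * P * (h + 2 - X) := by
        have : 0 ≤ (h : ℝ) + 2 - X := by linarith
        positivity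
      linarith
    have h9 : (0 : ℝ) < h + 1 := by positivity
    rw [mul_assoc] at h6
    exact le_of_mul_le_mul_left h6 h9

theorem markov_step_ennreal {s p q X E F : ℝ≥0∞} {h : ℕ} (hsp : s + p = 1) (hp : p ≠ 0)
    (hq1 : q ≤ 1) (hE1 : E ≤ 1) (hq : q ≤ s + p * E)
    (hE : (h + 1) * (E + p ^ h) ≤ (h + 1) + p ^ h * F) (hX : p + s * X + p * F ≤ X) :
    (h + 2) * (q + p ^ (h + 1)) ≤ (h + 2) + p ^ (h + 1) * X := by
  rcases eq_or_ne X ∞ with rfl | hXt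
  · rw [ENNReal.mul_top (pow_ne_zero _ hp), add_top]
    exact le_top
  have hpt : p ≠ ∞ := ne_top_of_le_ne_top ENNReal.one_ne_top (hsp ▸ le_add_self)
  have hst : s ≠ ∞ := ne_top_of_le_ne_top ENNReal.one_ne_top (hsp ▸ le_self_add)
  have hqt : q ≠ ∞ := ne_top_of_le_ne_top ENNReal.one_ne_top hq1
  have hEt : E ≠ ∞ := ne_top_of_le_ne_top ENNReal.one_ne_top hE1
  have hFt : F ≠ ∞ := by
    rintro rfl
    rw [ENNReal.mul_top hp, add_top] at hX
    exact hXt (top_le_iff.1 hX)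
  lift s to ℝ≥0 using hst
  lift p to ℝ≥0 using hpt
  lift q to ℝ≥0 using hqt
  lift X to ℝ≥0 using hXt
  lift E to ℝ≥0 using hEt
  lift F to ℝ≥0 using hFt
  norm_cast at hsp hp hq1 hE1 hq hE hX ⊢
  have hsp' : (s : ℝ) + p = 1 := by exact_mod_cast hsp
  have hp' : (0 : ℝ) < p := by
    have := p.2
    exact lt_of_le_of_ne this (by exact_mod_cast Ne.symm hp)
  have := markov_step (s := s) (p := p) (q := q) (X := X) (E := E) (F := F) (h := h) hsp' hp'
    (by exact_mod_cast hq1) (by exact_mod_cast hq) (by exact_mod_cast hE) (by exact_mod_cast hX)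
  exact_mod_cast this

/-- A pair at `x` jumps at least once. This settles the exponent 0, where the induction cannot lower
`h`. -/
theorem one_le_of_step {s p X : ℝ≥0∞} (hsp : s + p = 1) (hp : p ≠ 0) (hX : p + s * X ≤ X) :
    1 ≤ X := by
  rcases eq_or_ne X ∞ with rfl | hXt
  · exact le_top
  have hpt : p ≠ ∞ := ne_top_of_le_ne_top ENNReal.one_ne_top (hsp ▸ le_add_self)
  have hst : s ≠ ∞ := ne_top_of_le_ne_top ENNReal.one_ne_top (hsp ▸ le_self_add)
  have h1 : p + s * X ≤ p * X + s * X := by rwa [← add_mul, add_comm p s, hsp, one_mul]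
  have h2 : p * 1 ≤ p * X := by
    rw [mul_one]
    exact (ENNReal.add_le_add_iff_right (ENNReal.mul_ne_top hst hXt)).1 h1
  exact (ENNReal.mul_le_mul_iff_right hp hpt).1 h2

/-- The key estimate: a function `q` that satisfies the inequalities of the probability to find a
sleeping particle at `x` is controlled by the expected number of additional topplings of `x`
caused by an additional particle at `x`. -/
theorem sleeping_bound {G : SimpleGraph V} [G.LocallyFinite] {s p : ℝ≥0∞} {K : Finset V} {x : V}
    (hsp : s + p = 1) (hp : p ≠ 0) (hG : ∀ v, 0 < G.degree v) (hx : x ∈ K)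
    {q : ℕ → (V → SiteState) → ℝ≥0∞} (hq1 : ∀ k η, q k η ≤ 1)
    (hq0 : ∀ η, η x ≠ .sleeping → q 0 η = 0)
    (hqs : ∀ k η, (∀ y ∈ K, ¬ (η y).Unstable) → η x ≠ .sleeping → q k η = 0)
    (hqn : ∀ k η, ∀ y ∈ K, (η y).Unstable →
      q (k + 1) η ≤ avg G s p y fun i => q k (i.perform y η))
    (k h : ℕ) (η : V → SiteState) (hη : η x ≠ .sleeping) :
    (h + 1) * (q k η + p ^ h) + p ^ h * weakValSup G s p K x η ≤
      (h + 1) + p ^ h * weakValSup G s p K x (addAt x η) := by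
  have hp1 : p ≤ 1 := hsp ▸ le_add_self
  have hpow : ∀ h : ℕ, p ^ h ≤ 1 := fun h => pow_le_one' hp1 h
  have triv : ∀ (k h : ℕ) η, q k η = 0 →
      (h + 1) * (q k η + p ^ h) + p ^ h * weakValSup G s p K x η ≤
      (h + 1) + p ^ h * weakValSup G s p K x (addAt x η) := fun k h η e => by
    rw [e, zero_add]
    gcongr
    · exact mul_le_of_le_one_right' (hpow h)
    · exact weakValSup_le_addAt η
  induction k generalizing h η with
  | zero => exact_mod_cast triv 0 h η (hq0 η hη)
  | succ k ih =>
    -- A weakly legal toppling is performed both with and without the additional particle. The claim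
    -- is affine in `q` and in the two values, so it survives averaging, and the two costs cancel.
    by_cases hw : ∃ y, WeakLegal K x y η
    · obtain ⟨y, hy⟩ := hw
      calc (h + 1) * (q (k + 1) η + p ^ h) + p ^ h * weakValSup G s p K x η
          ≤ (h + 1) * (avg G s p y (fun i => q k (i.perform y η)) + p ^ h) +
            p ^ h * (cost p x y + avg G s p y fun i => weakValSup G s p K x (i.perform y η)) := by
            gcongr
            · exact hqn k η y hy.1 hy.2.1
            · exact weakValSup_le hsp hG hy
        _ = p ^ h * cost p x y + avg G s p y (fun i =>
            (h + 1) * (q k (i.perform y η) + p ^ h) +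
              p ^ h * weakValSup G s p K x (i.perform y η)) := by
            rw [avg_add, avg_mul, avg_mul, avg_add, avg_const hsp (hG y)]
            ring
        _ ≤ p ^ h * cost p x y + avg G s p y (fun i =>
            (h + 1) + p ^ h * weakValSup G s p K x (i.perform y (addAt x η))) := by
            gcongr
            refine avg_mono fun i => ?_
            rw [← addAt_perform hy.2.1]
            exact ih h _ (hy.perform_ne_sleeping hη i)
        _ = (h + 1) + p ^ h * (cost p x y +
            avg G s p y fun i => weakValSup G s p K x (i.perform y (addAt x η))) := by
            rw [avg_const_add hsp (hG y), avg_mul]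
            ring
        _ ≤ _ := by
            gcongr
            exact le_weakValSup hy.addAt
    -- The weak stabilization is over: `x` carries at most one active particle and the rest of `K`
    -- is stable.
    · push Not at hw
      rw [weakValSup_eq_zero hw, mul_zero, add_zero]
      have hst : ∀ y ∈ K, y ≠ x → ¬ (η y).Unstable := fun y hy hyx hu =>
        hw y ⟨hy, hu, fun h => (hyx h).elim⟩
      rcases hηx : η x with _ | n
      · exact (hη hηx).elim
      rcases n with _ | _ | n
      · have hst' : ∀ y ∈ K, ¬ (η y).Unstable := fun y hy => by
          by_cases hyx : y = x
          · rw [hyx, hηx]; simp [SiteState.Unstable]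
          · exact hst y hy hyx
        have := triv (k + 1) h η (hqs (k + 1) η hst' hη)
        rwa [weakValSup_eq_zero hw, mul_zero, add_zero] at this
      · have hu : (η x).Unstable := by rw [hηx]; exact le_rfl
        have hl : WeakLegal K x x (addAt x η) := by
          refine ⟨hx, ?_, fun _ => ⟨0, ?_⟩⟩ <;> simp [addAt, hηx, SiteState.add, SiteState.Unstable]
        -- With the additional particle `x` carries a pair, so "sleep" changes nothing; this
        -- produces the term `s * X` in `hX`.
        have hsl : (Instr.sleep : Instr V).perform x (addAt x η) = addAt x η := by
          funext v
          by_cases hv : v = x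
          · simp [perform_sleep_apply, addAt, hηx, hv, SiteState.add, SiteState.fallAsleep]
          · simp [perform_sleep_apply, hv]
        have hX : p + s * weakValSup G s p K x (addAt x η) +
            p * nbrMean G x (fun w =>
              weakValSup G s p K x (addAt x ((Instr.jump w).perform x η))) ≤
            weakValSup G s p K x (addAt x η) := by
          have := le_weakValSup (G := G) (s := s) (p := p) hl
          rw [avg_eq, hsl, ← add_assoc] at this
          simp only [← addAt_perform hu] at this
          simpa [cost] using this
        have hq : q (k + 1) η ≤ s + p * nbrMean G x (fun w => q k ((Instr.jump w).perform x η)) := by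
          refine (hqn k η x hx hu).trans ?_
          rw [avg_eq]
          gcongr
          exact mul_le_of_le_one_right' (hq1 _ _)
        -- Each jump of a lone particle from `x` uses up one of the `h` factors `p`.
        rcases h with _ | h
        · have h1 : (1 : ℝ≥0∞) ≤ weakValSup G s p K x (addAt x η) := by
            exact one_le_of_step hsp hp (le_self_add.trans hX)
          simp only [Nat.cast_zero, pow_zero]
          rw [zero_add, one_mul, one_mul, add_comm]
          exact add_le_add le_rfl ((hq1 _ _).trans h1)
        · have := markov_step_ennreal (h := h) hsp hp (hq1 (k + 1) η)
            (E := nbrMean G x (fun w => q k ((Instr.jump w).perform x η))) ?_ hq ?_ hX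
          · push_cast
            rw [add_assoc, one_add_one_eq_two]
            exact this
          · exact (nbrMean_mono fun w => hq1 _ _).trans_eq (nbrMean_const (hG x) 1)
          · have h2 : ∀ w, (h + 1) * (q k ((Instr.jump w).perform x η) + p ^ h) ≤ (h + 1) +
                p ^ h * weakValSup G s p K x (addAt x ((Instr.jump w).perform x η)) := fun w => by
              refine le_trans le_self_add (ih h _ ?_)
              rw [perform_jump hu]
              simp only [hop, addAt, hηx, SiteState.pop]
              grind [SiteState.add]
            have h3 := nbrMean_mono (G := G) (y := x) h2
            rwa [nbrMean_mul, nbrMean_add, nbrMean_const (hG x), nbrMean_const_add (hG x),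
              nbrMean_mul] at h3
      · exact (hw x ⟨hx, by rw [hηx]; exact Nat.le_add_left 1 _, fun _ => ⟨n, hηx⟩⟩).elim

/-! ### The random walk killed outside a finite set -/

/-- The probability that the walk started at `x ∈ K` stays in `K` up to time `t` and is then
at `w`. -/
def killed (G : SimpleGraph V) [G.LocallyFinite] (K : Finset V) (x : V) : ℕ → V → ℝ≥0∞
  | 0, w => open Classical in if w = x then 1 else 0
  | t + 1, w => open Classical in if w ∈ K then
      ∑ v ∈ K, (if G.Adj v w then killed G K x t v * (G.degree v : ℝ≥0∞)⁻¹ else 0) else 0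

/-- The expected number of visits to `w` of the walk started at `x` and killed outside `K`. -/
def killedSum (G : SimpleGraph V) [G.LocallyFinite] (K : Finset V) (x w : V) : ℝ≥0∞ :=
  ∑' t, killed G K x t w

section Killed

variable {G : SimpleGraph V} [G.LocallyFinite] {K : Finset V} {x : V}

theorem killed_of_notMem (hx : x ∈ K) {w : V} (hw : w ∉ K) (t : ℕ) : killed G K x t w = 0 := by
  cases t with
  | zero => simp only [killed]; rw [if_neg]; rintro rfl; exact hw hx
  | succ t => simp [killed, hw]

theorem killedSum_of_notMem (hx : x ∈ K) {w : V} (hw : w ∉ K) : killedSum G K x w = 0 := by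
  simp [killedSum, killed_of_notMem hx hw]

theorem killedSum_eq {w : V} (hw : w ∈ K) :
    open Classical in killedSum G K x w = cost 1 x w +
      ∑ v ∈ K, if G.Adj v w then killedSum G K x v * (G.degree v : ℝ≥0∞)⁻¹ else 0 := by
  classical
  have h0 : killed G K x 0 w = cost 1 x w := by simp [killed, cost]
  unfold killedSum
  rw [tsum_eq_zero_add' ENNReal.summable, h0]
  congr 1
  simp only [killed, if_pos hw]
  rw [Summable.tsum_finsetSum fun _ _ => ENNReal.summable]
  refine Finset.sum_congr rfl fun v _ => ?_
  split_ifs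
  · exact ENNReal.tsum_mul_right
  · exact tsum_zero

/-- By `killedSum_eq` at `v`, the sum at `v` is at least the sum at `w` divided by the degree of
`w`. -/
theorem killedSum_ne_top_of_adj {v w : V} (hv : v ∈ K) (hw : w ∈ K)
    (h : G.Adj v w) (hf : killedSum G K x v ≠ ∞) : killedSum G K x w ≠ ∞ := by
  classical
  intro hw'
  apply hf
  rw [killedSum_eq hv, ENNReal.add_eq_top]
  right
  rw [ENNReal.sum_eq_top]
  refine ⟨w, hw, ?_⟩
  rw [if_pos h.symm, hw']
  exact ENNReal.top_mul (ENNReal.inv_ne_zero.2 (ENNReal.natCast_ne_top _))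

/-- Finiteness spreads from `x` along paths in `K`, and the sum vanishes at vertices never reached.
Nothing is assumed about the walk leaving `K`. -/
theorem killedSum_ne_top (hx : x ∈ K)
    (hf : killedSum G K x x ≠ ∞) (w : V) : killedSum G K x w ≠ ∞ := by
  classical
  have key : ∀ t w, killed G K x t w ≠ 0 → w ∈ K ∧ killedSum G K x w ≠ ∞ := by
    intro t
    induction t with
    | zero =>
      intro w hw
      have : w = x := by by_contra h; simp [killed, h] at hw
      exact ⟨this ▸ hx, this ▸ hf⟩
    | succ t ih =>
      intro w hw
      have hwK : w ∈ K := by by_contra h; exact hw (killed_of_notMem hx h _)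
      simp only [killed, if_pos hwK] at hw
      obtain ⟨v, hv, hv'⟩ := Finset.exists_ne_zero_of_sum_ne_zero hw
      have hadj : G.Adj v w := by by_contra h; simp [h] at hv'
      rw [if_pos hadj] at hv'
      exact ⟨hwK, killedSum_ne_top_of_adj hv hwK hadj (ih v (left_ne_zero_of_mul hv')).2⟩
  by_cases h : ∃ t, killed G K x t w ≠ 0
  · obtain ⟨t, ht⟩ := h
    exact (key t w ht).2
  · push Not at h
    simp [killedSum, h]

theorem nbrMean_eq_sum {f : V → ℝ≥0∞} (hf : ∀ v, v ∉ K → f v = 0) (y : V) :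
    open Classical in
    nbrMean G y f = ∑ v ∈ K, if G.Adj y v then (G.degree y : ℝ≥0∞)⁻¹ * f v else 0 := by
  classical
  rw [← Finset.sum_filter]
  symm
  refine Finset.sum_subset_zero_on_sdiff (fun v hv => ?_) (fun v hv => ?_) fun _ _ => rfl
  · simpa using (Finset.mem_filter.1 hv).2
  · simp only [Finset.mem_sdiff, SimpleGraph.mem_neighborFinset, Finset.mem_filter] at hv
    rw [hf v fun h => hv.2 ⟨h, hv.1⟩, mul_zero]

/-- Iterates the hypothesis `t` times along the walk; the last sum is the part of `ψ` still alive at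
time `t`. -/
theorem le_sum_killed (hx : x ∈ K) {ψ : V → ℝ≥0∞} (h0 : ∀ v, v ∉ K → ψ v = 0)
    (hψ : ∀ w ∈ K, ψ w ≤ cost 1 x w + nbrMean G w ψ) (t : ℕ) :
    ψ x ≤ ∑ r ∈ Finset.range t, killed G K x r x + ∑ w ∈ K, killed G K x t w * ψ w := by
  classical
  induction t with
  | zero => simp [killed, hx]
  | succ t ih =>
    refine ih.trans ?_
    rw [Finset.sum_range_succ, add_assoc]
    gcongr
    calc ∑ w ∈ K, killed G K x t w * ψ w
        ≤ ∑ w ∈ K, (killed G K x t w * cost 1 x w + ∑ v ∈ K,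
            if G.Adj w v then killed G K x t w * (G.degree w : ℝ≥0∞)⁻¹ * ψ v else 0) := by
          refine Finset.sum_le_sum fun w hw => ?_
          calc _ ≤ killed G K x t w * (cost 1 x w + nbrMean G w ψ) := by gcongr; exact hψ w hw
            _ = _ := by
              rw [nbrMean_eq_sum h0, mul_add, Finset.mul_sum]
              simp only [mul_ite, mul_zero, mul_assoc]
      _ = killed G K x t x + ∑ v ∈ K, killed G K x (t + 1) v * ψ v := by
          rw [Finset.sum_add_distrib]
          congr 1
          · simp [cost, hx]
          · rw [Finset.sum_comm]
            refine Finset.sum_congr rfl fun v hv => ?_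
            simp only [killed, if_pos hv, Finset.sum_mul, ite_mul, zero_mul]
      _ ≤ _ := le_rfl

/-- The maximum principle for the killed walk. -/
theorem le_killedSum (hx : x ∈ K) {ψ : V → ℝ≥0∞} {B : ℝ≥0∞}
    (hB : B ≠ ∞) (hψB : ∀ v, ψ v ≤ B) (h0 : ∀ v, v ∉ K → ψ v = 0)
    (hψ : ∀ w ∈ K, ψ w ≤ cost 1 x w + nbrMean G w ψ) : ψ x ≤ killedSum G K x x := by
  rcases eq_or_ne (killedSum G K x x) ∞ with e | hf
  · rw [e]; exact le_top
  -- The terms of a convergent series tend to 0, so the mass left in the finite set `K` vanishes,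
  -- and with it the remainder for bounded `ψ`.
  have h1 : ∀ w, Filter.Tendsto (fun t => killed G K x t w) Filter.atTop (nhds 0) := fun w =>
    ENNReal.tendsto_atTop_zero_of_tsum_ne_top (killedSum_ne_top hx hf w)
  have h2 : Filter.Tendsto (fun t => killedSum G K x x + ∑ w ∈ K, killed G K x t w * B)
      Filter.atTop (nhds (killedSum G K x x + ∑ w ∈ K, 0 * B)) := by
    refine Filter.Tendsto.add tendsto_const_nhds (tendsto_finsetSum _ fun w _ => ?_)
    exact ENNReal.Tendsto.mul_const (h1 w) (Or.inr hB)
  simp only [zero_mul, Finset.sum_const_zero, add_zero] at h2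
  refine ge_of_tendsto' h2 fun t => (le_sum_killed hx h0 hψ t).trans ?_
  gcongr
  · exact ENNReal.sum_le_tsum _
  · exact hψB _

/-! ### Comparison of the weak stabilizations with and without an additional particle -/

/-- The configuration of `n v` active particles at each `v`. -/
def allActive (n : V → ℕ) : V → SiteState := fun v => .active (n v)

/-- With no sleepers the added particle can be carried on without trace; a sleeper at `w` would have
been woken by its arrival. -/
theorem hop_addAt_allActive (n : V → ℕ) (w v : V) :
    hop w v (addAt w (allActive n)) = addAt v (allActive n) := by
  funext u
  simp only [hop, addAt, allActive]
  by_cases hu : u = w <;> simp [hu, SiteState.add, SiteState.pop]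

/-- The maximum principle is applied to the excess due to a particle added at `v`, as a function of
`v`. The horizon `k` stays finite to keep this excess bounded. -/
theorem weakVal_addAt_le {s p : ℝ≥0∞} (hsp : s + p = 1) (hG : ∀ v, 0 < G.degree v) (hx : x ∈ K)
    (n : V → ℕ) (k : ℕ) :
    weakVal G s p K x k (addAt x (allActive n)) ≤
      weakVal G s p K x k (allActive n) + killedSum G K x x := by
  set c := weakVal G s p K x k (allActive n)
  have h := le_killedSum (G := G) (K := K) (x := x)
    (ψ := fun v => weakVal G s p K x k (addAt v (allActive n)) - c) hx
    (ENNReal.natCast_ne_top k) (fun v => tsub_le_self.trans (weakVal_le_natCast hsp hG k _))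
    (fun v hv => ?_) (fun w _ => ?_)
  · exact tsub_le_iff_left.1 h
  -- A particle added outside `K` has no influence.
  · refine tsub_eq_zero_of_le (weakVal_congr k (fun u hu => ?_) hx).le
    have : u ≠ v := fun e => hv (e ▸ hu)
    simp [addAt, this]
  · rw [tsub_le_iff_left]
    have hocc : (addAt w (allActive n) w).Occupied := by
      simp [addAt, allActive, SiteState.add, SiteState.Occupied]
    refine (weakVal_le_hop hsp hG k hocc).trans ?_
    simp only [hop_addAt_allActive]
    rw [add_left_comm]
    gcongr
    rw [← nbrMean_const_add (hG w)]
    exact nbrMean_mono fun v => le_add_tsub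

theorem weakValSup_addAt_le {s p : ℝ≥0∞} (hsp : s + p = 1) (hG : ∀ v, 0 < G.degree v)
    (hx : x ∈ K) (n : V → ℕ) :
    weakValSup G s p K x (addAt x (allActive n)) ≤
      weakValSup G s p K x (allActive n) + killedSum G K x x :=
  iSup_le fun k => (weakVal_addAt_le hsp hG hx n k).trans <| by
    gcongr
    exact le_iSup (fun k => weakVal G s p K x k (allActive n)) k

/-! ### The expected number of topplings is finite -/

/-- The number of particles at a vertex. -/
def SiteState.count : SiteState → ℕ
  | .sleeping => 1
  | .active n => n

/-- The expected number of visits to `x` of the walk started at `w` and killed outside `K`. -/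
def backSum (G : SimpleGraph V) [G.LocallyFinite] (K : Finset V) (x w : V) : ℝ≥0∞ :=
  G.degree x * (killedSum G K x w * (G.degree w : ℝ≥0∞)⁻¹)

/-- The expected number of visits to `x` of independent killed walks started from the particles
of `η`. -/
def potential (G : SimpleGraph V) [G.LocallyFinite] (K : Finset V) (x : V) (η : V → SiteState) :
    ℝ≥0∞ :=
  ∑ w ∈ K, (η w).count * backSum G K x w

theorem backSum_of_notMem (hx : x ∈ K) {w : V} (hw : w ∉ K) : backSum G K x w = 0 := by
  simp [backSum, killedSum_of_notMem hx hw]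

/-- Reversibility: the factor `deg x / deg w` turns the recursion of `killedSum` in the endpoint
into one in the starting point. -/
theorem backSum_eq (hG : ∀ v, 0 < G.degree v) (hx : x ∈ K) {w : V} (hw : w ∈ K) :
    backSum G K x w = cost 1 x w + nbrMean G w (backSum G K x) := by
  classical
  rw [nbrMean_eq_sum fun v => backSum_of_notMem hx, backSum, killedSum_eq hw, add_mul, mul_add]
  congr 1
  · unfold cost
    split_ifs with h
    · rw [h, one_mul, ENNReal.mul_inv_cancel (by exact_mod_cast (hG x).ne') (by simp)]
    · simp
  · rw [Finset.sum_mul, Finset.mul_sum]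
    refine Finset.sum_congr rfl fun v _ => ?_
    by_cases h : G.Adj v w
    · rw [if_pos h, if_pos h.symm, backSum]; ring
    · rw [if_neg h, if_neg fun h' => h h'.symm]; simp

theorem backSum_ne_top (hG : ∀ v, 0 < G.degree v) (hx : x ∈ K)
    (hf : killedSum G K x x ≠ ∞) (w : V) : backSum G K x w ≠ ∞ :=
  ENNReal.mul_ne_top (ENNReal.natCast_ne_top _) <|
    ENNReal.mul_ne_top (killedSum_ne_top hx hf w)
      (ENNReal.inv_ne_top.2 (by exact_mod_cast (hG w).ne'))

theorem count_hop {y w : V} {η : V → SiteState} (hy : (η y).Occupied) (v : V) :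
    open Classical in (hop y w η v).count + (if v = y then 1 else 0) =
      (η v).count + (if v = w then 1 else 0) := by
  classical
  have hadd : ∀ a : SiteState, a.add.count = a.count + 1 := fun a => by cases a <;> rfl
  have hpop : (η y).pop.count + 1 = (η y).count := by
    cases h : η y with
    | sleeping => rfl
    | active n =>
      rw [h] at hy
      change n - 1 + 1 = n
      exact Nat.sub_add_cancel hy
  simp only [hop, addAt]
  by_cases h1 : v = y
  · subst h1
    by_cases h2 : v = w
    · rw [if_pos h2, if_pos rfl, if_pos rfl, if_pos h2, hadd]; omega
    · rw [if_neg h2, if_pos rfl, if_pos rfl, if_neg h2]; omega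
  · by_cases h2 : v = w
    · rw [if_pos h2, if_neg h1, if_neg h1, if_pos h2, hadd]
    · rw [if_neg h2, if_neg h1, if_neg h1, if_neg h2]

theorem potential_hop (hx : x ∈ K) {y w : V} {η : V → SiteState}
    (hy : (η y).Occupied) :
    potential G K x (hop y w η) + backSum G K x y = potential G K x η + backSum G K x w := by
  classical
  have h1 : ∀ u, backSum G K x u =
      ∑ v ∈ K, ((if v = u then 1 else 0 : ℕ) : ℝ≥0∞) * backSum G K x v := fun u => by
    by_cases hu : u ∈ K
    · simp [hu]
    · simp [hu, backSum_of_notMem hx hu]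
  rw [h1 y, h1 w, potential, potential, ← Finset.sum_add_distrib, ← Finset.sum_add_distrib]
  refine Finset.sum_congr rfl fun v _ => ?_
  rw [← add_mul, ← add_mul]
  congr 1
  exact_mod_cast count_hop hy v

/-- "Sleep" preserves the potential, and a jump from `y` lowers its mean by `cost 1 x y`. The
potential thus pays for all the jumps from `x`. -/
theorem weakVal_le_potential {s p : ℝ≥0∞} (hsp : s + p = 1) (hG : ∀ v, 0 < G.degree v)
    (hx : x ∈ K) (hf : killedSum G K x x ≠ ∞) (k : ℕ) (η : V → SiteState) :
    weakVal G s p K x k η ≤ potential G K x η := by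
  induction k generalizing η with
  | zero => exact zero_le
  | succ k ih =>
    refine iSup₂_le fun y hy => ?_
    have h1 : nbrMean G y (fun w => potential G K x (hop y w η)) + cost 1 x y =
        potential G K x η := by
      have h2 : nbrMean G y (fun w => potential G K x (hop y w η) + backSum G K x y) =
          nbrMean G y (fun w => potential G K x η + backSum G K x w) := by
        simp only [potential_hop hx hy.2.1.occupied]
      rw [nbrMean_add, nbrMean_const (hG y), nbrMean_const_add (hG y), backSum_eq hG hx hy.1,
        ← add_assoc] at h2
      refine (ENNReal.add_left_inj ?_).1 h2
      refine (ENNReal.sum_lt_top.2 fun w _ => ?_).ne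
      exact ENNReal.mul_lt_top (ENNReal.inv_ne_top.2 (by exact_mod_cast (hG y).ne')).lt_top
        (backSum_ne_top hG hx hf w).lt_top
    have h3 : potential G K x ((Instr.sleep : Instr V).perform y η) = potential G K x η := by
      have hc : ∀ a : SiteState, a.fallAsleep.count = a.count := fun a => by
        cases a with
        | sleeping => rfl
        | active n => by_cases h : n = 1 <;> simp [SiteState.fallAsleep, h, SiteState.count]
      refine Finset.sum_congr rfl fun v _ => ?_
      rw [perform_sleep_apply]
      split_ifs
      · rw [hc]
      · rfl
    have h4 : cost p x y = p * cost 1 x y := by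
      unfold cost; split_ifs <;> simp
    calc _ ≤ cost p x y + avg G s p y fun i => potential G K x (i.perform y η) := by
          gcongr
          exact avg_mono fun i => ih _
      _ = s * potential G K x η +
          p * (nbrMean G y (fun w => potential G K x (hop y w η)) + cost 1 x y) := by
          rw [avg_eq, h3, h4]
          simp only [perform_jump hy.2.1]
          ring
      _ ≤ _ := by rw [h1, ← add_mul, hsp, one_mul]

theorem weakValSup_ne_top {s p : ℝ≥0∞} (hsp : s + p = 1) (hG : ∀ v, 0 < G.degree v)
    (hx : x ∈ K) (hf : killedSum G K x x ≠ ∞) (η : V → SiteState) :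
    weakValSup G s p K x η ≠ ∞ := by
  refine ne_top_of_le_ne_top ?_ (iSup_le fun k => weakVal_le_potential hsp hG hx hf k η)
  exact (ENNReal.sum_lt_top.2 fun w _ =>
    ENNReal.mul_lt_top (ENNReal.natCast_lt_top _) (backSum_ne_top hG hx hf w).lt_top).ne

end Killed

/-! ### The Green function as the occupation measure of the killed walk -/

theorem stepLaw_toMeasure_singleton (G : SimpleGraph V) [G.LocallyFinite] [MeasurableSpace V]
    [DiscreteMeasurableSpace V] {v : V} (hv : 0 < G.degree v) (w : V) :
    open Classical in (stepLaw G v).toMeasure {w} =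
      if G.Adj v w then (G.degree v : ℝ≥0∞)⁻¹ else 0 := by
  classical
  have h : (G.neighborFinset v).Nonempty := by
    rwa [← Finset.card_pos, SimpleGraph.card_neighborFinset_eq_degree]
  rw [PMF.toMeasure_apply_singleton _ _ (MeasurableSet.singleton w), stepLaw, dif_pos h,
    PMF.uniformOfFinset_apply]
  simp

/-- The trajectories that stay in `K` up to time `t` and are then at `w`. -/
def stayEvent (K : Finset V) (t : ℕ) (w : V) : Set (ℕ → V) :=
  {X | (∀ r ≤ t, X r ∈ K) ∧ X t = w}

theorem natCast_lt_hittingTime_iff {K : Finset V} {X : ℕ → V} {t : ℕ} :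
    (t : ℕ∞) < hittingTime ((K : Set V)ᶜ) X ↔ ∀ r ≤ t, X r ∈ K := by
  constructor
  · intro h r hr
    by_contra hX
    have : hittingTime ((K : Set V)ᶜ) X ≤ (r : ℕ∞) := sInf_le ⟨r, by simpa using hX, rfl⟩
    exact absurd (h.trans_le this) (by exact_mod_cast not_lt.2 hr)
  · intro h
    have : ((t + 1 : ℕ) : ℕ∞) ≤ hittingTime ((K : Set V)ᶜ) X := by
      refine le_sInf ?_
      rintro _ ⟨r, hr, rfl⟩
      by_contra hlt
      exact hr (h r (Nat.lt_succ_iff.1 (Nat.cast_lt.1 (not_le.1 hlt))))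
    refine lt_of_lt_of_le ?_ this
    exact_mod_cast Nat.lt_succ_self t

section

variable {G : SimpleGraph V} [G.LocallyFinite] [MeasurableSpace V] [DiscreteMeasurableSpace V]
  {K : Finset V} {x : V}

instance : IsProbabilityMeasure (walkLaw G x) := by unfold walkLaw; infer_instance

theorem measurableSet_eval_eq {ι : Type*} (i : ι) (w : V) :
    MeasurableSet {X : ι → V | X i = w} := by
  have h : {X : ι → V | X i = w} = (fun X => X i) ⁻¹' {w} := by ext; simp
  rw [h]
  exact measurable_pi_apply i (MeasurableSet.singleton w)

theorem measurableSet_stayEvent (t : ℕ) (w : V) : MeasurableSet (stayEvent K t w) := by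
  have : stayEvent K t w = (⋂ r, ⋂ (_ : r ≤ t), {X : ℕ → V | X r ∈ K}) ∩ {X | X t = w} := by
    ext X; simp [stayEvent]
  rw [this]
  refine MeasurableSet.inter (MeasurableSet.iInter fun r => MeasurableSet.iInter fun _ => ?_) ?_
  · exact measurable_pi_apply r (MeasurableSet.of_discrete (s := (K : Set V)))
  · exact measurableSet_eval_eq t w

theorem walkLaw_map_frestrictLe (t : ℕ) :
    (walkLaw G x).map (Preorder.frestrictLe t) =
      Kernel.partialTraj (X := fun _ => V) (walkKernel G) 0 t (fun _ => x) := by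
  unfold walkLaw
  exact Kernel.traj_map_frestrictLe_apply (X := fun _ => V) (κ := walkKernel G) 0 t _

theorem walkLaw_zero : ∀ᵐ X ∂(walkLaw G x), X 0 = x := by
  have h := walkLaw_map_frestrictLe (G := G) (x := x) 0
  rw [Kernel.partialTraj_self, Kernel.id_apply] at h
  have hs : MeasurableSet {p : (Finset.Iic 0 → V) | p ⟨0, by simp⟩ = x} :=
    measurableSet_eval_eq _ x
  have h2 : ∀ᵐ p ∂((walkLaw G x).map (Preorder.frestrictLe (π := fun _ => V) 0)),
      p ⟨0, by simp⟩ = x := by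
    rw [h, ae_dirac_iff hs]
  exact ae_of_ae_map (by fun_prop) h2

/-- The event `stayEvent K t v` depends on the past up to time `t` only, and on it the transition
probability to `w` is constant. -/
theorem walkLaw_step (hG : ∀ v, 0 < G.degree v) (t : ℕ) (v w : V) :
    open Classical in walkLaw G x (stayEvent K t v ∩ {X | X (t + 1) = w}) =
      if G.Adj v w then walkLaw G x (stayEvent K t v) * (G.degree v : ℝ≥0∞)⁻¹ else 0 := by
  classical
  set A : Set (Finset.Iic t → V) := {p | (∀ r, p r ∈ K) ∧ p ⟨t, Finset.mem_Iic.2 le_rfl⟩ = v}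
  have hA : MeasurableSet A := by
    have : A = (⋂ r, {p : Finset.Iic t → V | p r ∈ K}) ∩
        {p | p ⟨t, Finset.mem_Iic.2 le_rfl⟩ = v} := by
      ext p; simp [A]
    rw [this]
    refine MeasurableSet.inter (MeasurableSet.iInter fun r => ?_) ?_
    · exact measurable_pi_apply r (MeasurableSet.of_discrete (s := (K : Set V)))
    · exact measurableSet_eval_eq _ v
  have hpre : Preorder.frestrictLe (π := fun _ => V) t ⁻¹' A = stayEvent K t v := by
    ext X
    simp [A, stayEvent, Preorder.frestrictLe]
  have key := Kernel.partialTraj_compProd_eq_map_traj (X := fun _ => V) (κ := walkKernel G)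
    (Nat.zero_le t) (x₀ := fun _ => x)
  have h1 := congrArg (fun μ => μ (A ×ˢ {w})) key
  rw [Measure.compProd_apply_prod hA (MeasurableSet.singleton w),
    Measure.map_apply (by fun_prop) (hA.prod (MeasurableSet.singleton w))] at h1
  have h2 : (fun X : ℕ → V => (Preorder.frestrictLe (π := fun _ => V) t X, X (t + 1))) ⁻¹'
      (A ×ˢ {w}) = stayEvent K t v ∩ {X | X (t + 1) = w} := by
    rw [← hpre]; rfl
  rw [h2] at h1
  refine h1.symm.trans ?_
  have h3 : ∀ p ∈ A, walkKernel G t p {w} = if G.Adj v w then (G.degree v : ℝ≥0∞)⁻¹ else 0 := by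
    intro p hp
    rw [← stepLaw_toMeasure_singleton G (hG v) w, ← hp.2]
    rfl
  rw [setLIntegral_congr_fun hA h3, setLIntegral_const, ← walkLaw_map_frestrictLe,
    Measure.map_apply (by fun_prop) hA, hpre, mul_comm, mul_ite, mul_zero]

theorem walkLaw_stayEvent (hG : ∀ v, 0 < G.degree v) (hx : x ∈ K) (t : ℕ) (w : V) :
    walkLaw G x (stayEvent K t w) = killed G K x t w := by
  classical
  induction t generalizing w with
  | zero =>
    by_cases hw : w = x
    · subst hw
      simp only [killed, if_pos]
      rw [prob_compl_eq_zero_iff (measurableSet_stayEvent 0 w) |>.1]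
      refine measure_mono_null ?_ (walkLaw_zero (G := G) (x := w))
      intro X hX h
      refine hX ⟨fun r hr => ?_, h⟩
      rw [Nat.le_zero.1 hr, h]; exact hx
    · simp only [killed, if_neg hw]
      refine measure_mono_null ?_ (walkLaw_zero (G := G) (x := x))
      intro X hX h
      exact hw (hX.2.symm.trans h)
  | succ t ih =>
    by_cases hw : w ∈ K
    · have h1 : stayEvent K (t + 1) w =
          ⋃ v ∈ K, stayEvent K t v ∩ {X | X (t + 1) = w} := by
        ext X
        simp only [stayEvent, Set.mem_ofPred_eq, Set.mem_iUnion, Set.mem_inter_iff, exists_prop]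
        constructor
        · rintro ⟨h, h'⟩
          exact ⟨X t, h t (Nat.le_succ t), ⟨fun r hr => h r (hr.trans (Nat.le_succ t)), rfl⟩, h'⟩
        · rintro ⟨v, hv, ⟨h, h'⟩, h''⟩
          refine ⟨fun r hr => ?_, h''⟩
          rcases Nat.le_succ_iff.1 hr with hr | rfl
          · exact h r hr
          · rw [h'']; exact hw
      rw [h1, measure_biUnion_finset]
      · simp only [killed, if_pos hw]
        refine Finset.sum_congr rfl fun v _ => ?_
        rw [walkLaw_step hG, ih]
      · intro v _ v' _ hvv
        refine Set.disjoint_left.2 fun X hX hX' => hvv (hX.1.2.symm.trans hX'.1.2)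
      · intro v _
        exact (measurableSet_stayEvent t v).inter
          (measurableSet_eval_eq (t + 1) w)
    · rw [killed_of_notMem hx hw]
      convert measure_empty (μ := walkLaw G x)
      ext X
      simp only [stayEvent, Set.mem_ofPred_eq, Set.mem_empty_iff_false, iff_false, not_and]
      intro h h'
      exact hw (h' ▸ h (t + 1) le_rfl)

theorem green_eq_killedSum (hG : ∀ v, 0 < G.degree v) (hx : x ∈ K) :
    green G ((K : Set V)ᶜ) x x = killedSum G K x x := by
  classical
  unfold green killedSum
  simp only [natCast_lt_hittingTime_iff]
  have h : ∀ (X : ℕ → V) (t : ℕ), (if (∀ r ≤ t, X r ∈ K) ∧ X t = x then (1 : ℝ≥0∞) else 0) =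
      (stayEvent K t x).indicator 1 X := fun X t => by
    simp [Set.indicator_apply, stayEvent]
  simp only [h]
  rw [lintegral_tsum fun t =>
    (measurable_one.indicator (measurableSet_stayEvent t x)).aemeasurable]
  refine tsum_congr fun t => ?_
  rw [lintegral_indicator_one (measurableSet_stayEvent t x), walkLaw_stayEvent hG hx]

end

/-! ### The abelian property -/

theorem unstable_topple {τ : V × ℕ → Instr V} {y z : V} (h : z ≠ y)
    {s : (V → SiteState) × (V → ℕ)} (hz : (s.1 z).Unstable) : ((topple τ y s).1 z).Unstable :=
  unstable_perform h _ hz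

theorem topple_topple {τ : V × ℕ → Instr V} {y z : V} (hyz : y ≠ z)
    {s : (V → SiteState) × (V → ℕ)} (hy : (s.1 y).Unstable) (hz : (s.1 z).Unstable) :
    topple τ y (topple τ z s) = topple τ z (topple τ y s) := by
  classical
  unfold topple
  ext1
  · simp only [Function.update_of_ne hyz, Function.update_of_ne hyz.symm]
    exact perform_perform hyz hy hz _ _
  · simp only [Function.update_of_ne hyz, Function.update_of_ne hyz.symm]
    exact Function.update_comm hyz.symm _ _ _

/-- In a legal sequence that stabilizes `y`, the first toppling of `y` can be moved to the front. -/
theorem exists_legal_after_topple {τ : V × ℕ → Instr V} {y : V} (α : List V)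
    {s : (V → SiteState) × (V → ℕ)} (hy : (s.1 y).Unstable) (hα : IsLegal τ α s)
    (hst : ¬ ((toppleList τ α s).1 y).Unstable) :
    ∃ β : List V, α.length = β.length + 1 ∧ (∀ z ∈ β, z ∈ α) ∧ IsLegal τ β (topple τ y s) ∧
      toppleList τ β (topple τ y s) = toppleList τ α s := by
  induction α generalizing s with
  | nil => exact (hst hy).elim
  | cons z α ih =>
    by_cases hyz : y = z
    · subst hyz
      exact ⟨α, rfl, fun z hz => List.mem_cons_of_mem _ hz, hα.2, rfl⟩
    · obtain ⟨β, hlen, hmem, hleg, hfin⟩ := ih (unstable_topple hyz hy) hα.2 hst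
      rw [topple_topple hyz hy hα.1] at hleg hfin
      refine ⟨z :: β, by simp [hlen], fun w hw => ?_,
        ⟨unstable_topple (Ne.symm hyz) hα.1, hleg⟩, hfin⟩
      rcases List.mem_cons.1 hw with rfl | hw
      · exact List.mem_cons_self
      · exact List.mem_cons_of_mem _ (hmem w hw)

/-- Legal sequences of topplings in `K` only depend on the configuration in `K` and on the
instructions of `K` that have not been used. -/
theorem toppleList_congr {K : Finset V} {τ τ' : V × ℕ → Instr V} (α : List V)
    (hα : ∀ y ∈ α, y ∈ K) {s s' : (V → SiteState) × (V → ℕ)} (hs : ∀ v ∈ K, s.1 v = s'.1 v)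
    (hτ : ∀ v ∈ K, ∀ j, τ (v, s.2 v + j) = τ' (v, s'.2 v + j)) (hleg : IsLegal τ α s) :
    IsLegal τ' α s' ∧ ∀ v ∈ K, (toppleList τ α s).1 v = (toppleList τ' α s').1 v := by
  classical
  induction α generalizing s s' with
  | nil => exact ⟨trivial, hs⟩
  | cons y α ih =>
    have hy : y ∈ K := hα y List.mem_cons_self
    have h0 : τ (y, s.2 y) = τ' (y, s'.2 y) := hτ y hy 0
    obtain ⟨h1, h2⟩ := ih (fun z hz => hα z (List.mem_cons_of_mem _ hz))
      (s := topple τ y s) (s' := topple τ' y s')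
      (by
        simp only [topple, h0]
        exact perform_congr hy _ hs)
      (fun v hv j => by
        simp only [topple]
        by_cases hvy : v = y
        · subst hvy
          simp only [Function.update_self, add_assoc]
          exact hτ v hv (1 + j)
        · simp only [Function.update_of_ne hvy]
          exact hτ v hv j)
      hleg.2
    exact ⟨⟨hs y hy ▸ hleg.1, h1⟩, h2⟩

/-- Some legal sequence of at most `k` topplings stabilizes `K` and leaves a sleeping particle
at `x`. -/
def AsleepWithin (τ : V × ℕ → Instr V) (K : Finset V) (x : V) (k : ℕ) (η : V → SiteState) : Prop :=
  ∃ α : List V, α.length ≤ k ∧ (∀ y ∈ α, y ∈ K) ∧ IsLegal τ α (η, fun _ => 0) ∧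
    (∀ y ∈ K, ¬ ((toppleList τ α (η, fun _ => 0)).1 y).Unstable) ∧
    (toppleList τ α (η, fun _ => 0)).1 x = .sleeping

/-- Remove the first instruction at `y`. -/
def shiftStack (y : V) (τ : V × ℕ → Instr V) : V × ℕ → Instr V :=
  open Classical in fun q => if q.1 = y then τ (q.1, q.2 + 1) else τ q

theorem AsleepWithin.congr {τ : V × ℕ → Instr V} {K : Finset V} {x : V} (hx : x ∈ K) {k : ℕ}
    {η ζ : V → SiteState} (h : ∀ v ∈ K, η v = ζ v) (ha : AsleepWithin τ K x k η) :
    AsleepWithin τ K x k ζ := by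
  obtain ⟨α, hlen, hα, hleg, hst, hsl⟩ := ha
  obtain ⟨h1, h2⟩ := toppleList_congr (τ' := τ) (s := (η, fun _ => 0))
    (s' := (ζ, fun _ => 0)) α hα h
    (fun _ _ _ => rfl) hleg
  exact ⟨α, hlen, hα, h1, fun y hy => h2 y hy ▸ hst y hy, h2 x hx ▸ hsl⟩

/-- Since `y` ends stable it must be toppled at some point, and that toppling can come first. The
remaining ones read the stacks without the first instruction at `y`. -/
theorem AsleepWithin.step {τ : V × ℕ → Instr V} {K : Finset V} {x y : V} (hx : x ∈ K)
    (hy : y ∈ K) {k : ℕ} {η : V → SiteState} (hu : (η y).Unstable)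
    (h : AsleepWithin τ K x (k + 1) η) :
    AsleepWithin (shiftStack y τ) K x k ((τ (y, 0)).perform y η) := by
  classical
  obtain ⟨α, hlen, hα, hleg, hst, hsl⟩ := h
  obtain ⟨β, hβ, hmem, hleg', hfin⟩ := exists_legal_after_topple α (y := y) hu hleg (hst y hy)
  have hβK : ∀ z ∈ β, z ∈ K := fun z hz => hα z (hmem z hz)
  obtain ⟨h1, h2⟩ := toppleList_congr (K := K) (τ := τ) (τ' := shiftStack y τ)
    (s := topple τ y (η, fun _ => 0))
    (s' := ((τ (y, 0)).perform y η, fun _ => 0)) β hβK (fun _ _ => rfl)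
    (fun v _ j => by
      simp only [topple, shiftStack]
      by_cases hv : v = y
      · subst hv
        simp [add_comm]
      · simp [hv]) hleg'
  rw [hfin] at h2
  exact ⟨β, by omega, hβK, h1, fun z hz => h2 z hz ▸ hst z hz, h2 x hx ▸ hsl⟩

theorem AsleepWithin.mono {τ : V × ℕ → Instr V} {K : Finset V} {x : V} {k l : ℕ} (hkl : k ≤ l)
    {η : V → SiteState} (h : AsleepWithin τ K x k η) : AsleepWithin τ K x l η := by
  obtain ⟨α, hlen, h⟩ := h
  exact ⟨α, hlen.trans hkl, h⟩

theorem not_asleepWithin_of_stable {τ : V × ℕ → Instr V} {K : Finset V} {x : V} {k : ℕ}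
    {η : V → SiteState} (hst : ∀ y ∈ K, ¬ (η y).Unstable) (hx : η x ≠ .sleeping) :
    ¬ AsleepWithin τ K x k η := by
  rintro ⟨α, -, hα, hleg, -, hsl⟩
  cases α with
  | nil => exact hx hsl
  | cons y α => exact hst y (hα y List.mem_cons_self) hleg.1

theorem not_asleepWithin_zero {τ : V × ℕ → Instr V} {K : Finset V} {x : V}
    {η : V → SiteState} (hx : η x ≠ .sleeping) : ¬ AsleepWithin τ K x 0 η := by
  rintro ⟨α, hlen, -, -, -, hsl⟩
  rw [List.length_eq_zero_iff.1 (Nat.le_zero.1 hlen)] at hsl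
  exact hx hsl

/-! ### Removing an instruction from independent stacks -/

theorem measurable_shiftStack (y : V) : Measurable (shiftStack y) := by
  classical
  refine measurable_pi_lambda _ fun q => ?_
  unfold shiftStack
  by_cases h : q.1 = y
  · simp only [if_pos h]; exact measurable_pi_apply _
  · simp only [if_neg h]; exact measurable_pi_apply _

section Stacks

variable (κ : V → Measure (Instr V)) [∀ v, IsProbabilityMeasure (κ v)]

theorem measurableSet_first_eq (y : V) (i : Instr V) :
    MeasurableSet {τ : V × ℕ → Instr V | τ (y, 0) = i} := by
  have h : {τ : V × ℕ → Instr V | τ (y, 0) = i} = (fun τ => τ (y, 0)) ⁻¹' {i} := by ext; simp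
  rw [h]
  exact measurable_pi_apply _ (MeasurableSet.of_discrete)

/-- The shift is a reindexing by the injection `f`, whose range misses `(y, 0)`; the event is
therefore again a box. -/
theorem infinitePi_first_inter_shift_pi (y : V) (i : Instr V) (S : Finset (V × ℕ))
    (t : V × ℕ → Set (Instr V)) :
    Measure.infinitePi (fun q : V × ℕ => κ q.1)
      (shiftStack y ⁻¹' (Set.pi S t) ∩ {τ | τ (y, 0) = i}) =
      κ y {i} * ∏ q ∈ S, κ q.1 (t q) := by
  classical
  let f : V × ℕ → V × ℕ := fun q => if q.1 = y then (q.1, q.2 + 1) else q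
  let t' : V × ℕ → Set (Instr V) := fun q =>
    if q.1 = y then (if q.2 = 0 then {i} else t (q.1, q.2 - 1)) else t q
  have hf1 : ∀ q, (f q).1 = q.1 := fun q => by simp only [f]; split_ifs <;> rfl
  have hft : ∀ q, t' (f q) = t q := fun q => by
    by_cases h : q.1 = y <;> simp [f, t', h]
    rw [← h]
  have hft0 : t' (y, 0) = {i} := by simp [t']
  have hfi : Function.Injective f := fun q r hqr => by
    have h1 : q.1 = r.1 := by rw [← hf1 q, hqr, hf1]
    by_cases h : q.1 = y
    · have h' : r.1 = y := h1 ▸ h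
      simp only [f, if_pos h, if_pos h', Prod.mk.injEq, Nat.add_right_cancel_iff] at hqr
      exact Prod.ext hqr.1 hqr.2
    · have h' : r.1 ≠ y := h1 ▸ h
      simpa only [f, if_neg h, if_neg h'] using hqr
  have hf0 : (y, 0) ∉ S.image f := by
    intro h
    obtain ⟨q, -, hq⟩ := Finset.mem_image.1 h
    have h1 : q.1 = y := by rw [← hf1 q, hq]
    simp [f, h1] at hq
  have hset : shiftStack y ⁻¹' (Set.pi S t) ∩ {τ | τ (y, 0) = i} =
      Set.pi (↑(insert (y, 0) (S.image f)) : Set (V × ℕ)) t' := by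
    ext τ
    have hsh : ∀ q, shiftStack y τ q = τ (f q) := fun q => by
      simp only [shiftStack, f]; split_ifs <;> rfl
    simp only [Set.mem_inter_iff, Set.mem_preimage, Set.mem_pi, Finset.mem_coe,
      Set.mem_ofPred_eq, Finset.forall_mem_insert, Finset.forall_mem_image, hft, hft0, hsh,
      Set.mem_singleton_iff]
    exact and_comm
  rw [hset, Measure.infinitePi_pi _ fun _ _ => MeasurableSet.of_discrete,
    Finset.prod_insert hf0, Finset.prod_image hfi.injOn, hft0]
  simp only [hft, hf1]

/-- The law of the shifted stacks conditioned on the first instruction agrees with the product law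
on boxes, hence equals it. -/
theorem infinitePi_first_inter_shift (y : V) (i : Instr V) {T : Set (V × ℕ → Instr V)}
    (hT : MeasurableSet T) :
    Measure.infinitePi (fun q : V × ℕ => κ q.1) (shiftStack y ⁻¹' T ∩ {τ | τ (y, 0) = i}) =
      κ y {i} * Measure.infinitePi (fun q : V × ℕ => κ q.1) T := by
  set ν := Measure.infinitePi (fun q : V × ℕ => κ q.1)
  have hE := measurableSet_first_eq y i
  rcases eq_or_ne (κ y {i}) 0 with h0 | h0
  · rw [h0, zero_mul]
    refine measure_mono_null Set.inter_subset_right ?_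
    have := infinitePi_first_inter_shift_pi κ y i ∅ (fun _ => Set.univ)
    simpa [h0] using this
  have htop : κ y {i} ≠ ∞ := measure_ne_top _ _
  have hν : (κ y {i})⁻¹ • (ν.restrict {τ | τ (y, 0) = i}).map (shiftStack y) = ν := by
    refine Measure.eq_infinitePi _ fun S t _ => ?_
    have hm : MeasurableSet (Set.pi (S : Set (V × ℕ)) t) :=
      MeasurableSet.pi S.countable_toSet fun _ _ => MeasurableSet.of_discrete
    rw [Measure.smul_apply, Measure.map_apply (measurable_shiftStack y) hm,
      Measure.restrict_apply (measurable_shiftStack y hm), infinitePi_first_inter_shift_pi,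
      smul_eq_mul, ← mul_assoc, ENNReal.inv_mul_cancel h0 htop, one_mul]
  conv_rhs => rw [← hν]
  rw [Measure.smul_apply, Measure.map_apply (measurable_shiftStack y) hT,
    Measure.restrict_apply (measurable_shiftStack y hT), smul_eq_mul, ← mul_assoc,
    ENNReal.mul_inv_cancel h0 htop, one_mul]

/-- Passing to a measurable hull gives an inequality for arbitrary `T`, so the measurability of
stabilization events is never needed. -/
theorem infinitePi_first_inter_shift_le (y : V) (i : Instr V) (T : Set (V × ℕ → Instr V)) :
    Measure.infinitePi (fun q : V × ℕ => κ q.1) (shiftStack y ⁻¹' T ∩ {τ | τ (y, 0) = i}) ≤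
      κ y {i} * Measure.infinitePi (fun q : V × ℕ => κ q.1) T := by
  set ν := Measure.infinitePi (fun q : V × ℕ => κ q.1)
  rw [← measure_toMeasurable T, ← infinitePi_first_inter_shift κ y i (measurableSet_toMeasurable ν T)]
  exact measure_mono (Set.inter_subset_inter_left _ (Set.preimage_mono (subset_toMeasurable ν T)))

/-- Conditioning on the first instruction at `y`. -/
theorem infinitePi_le_sum_first (y : V) (I : Finset (Instr V)) (hI : κ y (I : Set (Instr V))ᶜ = 0)
    {S : Set (V × ℕ → Instr V)} {T : Instr V → Set (V × ℕ → Instr V)}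
    (hST : ∀ τ ∈ S, shiftStack y τ ∈ T (τ (y, 0))) :
    Measure.infinitePi (fun q : V × ℕ => κ q.1) S ≤
      ∑ i ∈ I, κ y {i} * Measure.infinitePi (fun q : V × ℕ => κ q.1) (T i) := by
  set ν := Measure.infinitePi (fun q : V × ℕ => κ q.1)
  have h0 : ν {τ | τ (y, 0) ∉ I} = 0 := by
    have h1 : {τ : V × ℕ → Instr V | τ (y, 0) ∉ I} =
        (fun τ => τ (y, 0)) ⁻¹' (I : Set (Instr V))ᶜ := by ext; simp
    rw [h1, ← Measure.map_apply (measurable_pi_apply _) MeasurableSet.of_discrete,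
      Measure.infinitePi_map_eval (fun q : V × ℕ => κ q.1) (y, 0)]
    exact hI
  have hsub : S ⊆ {τ | τ (y, 0) ∉ I} ∪ ⋃ i ∈ I, shiftStack y ⁻¹' (T i) ∩ {τ | τ (y, 0) = i} := by
    intro τ hτ
    by_cases h : τ (y, 0) ∈ I
    · right
      simp only [Set.mem_iUnion]
      exact ⟨τ (y, 0), h, hST τ hτ, rfl⟩
    · exact Or.inl h
  refine (measure_mono hsub).trans ((measure_union_le _ _).trans ?_)
  rw [h0, zero_add]
  refine (measure_biUnion_finset_le _ _).trans (Finset.sum_le_sum fun i _ => ?_)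
  exact infinitePi_first_inter_shift_le κ y i (T i)

end Stacks

/-! ### From the one-step inequality for the stacks to the bound on `Q` -/

section

variable {G : SimpleGraph V} [G.LocallyFinite] [MeasurableSpace V] [DiscreteMeasurableSpace V]
  {lam : ℝ} {K : Finset V} {x : V}

theorem instrLaw_singleton (hG : ∀ v, 0 < G.degree v) (y : V) {i : Instr V}
    (hi : i ∈ instrs G y) :
    instrLaw G lam y {i} =
      wt G (ENNReal.ofReal (lam / (1 + lam))) (ENNReal.ofReal (1 / (1 + lam))) y i := by
  classical
  simp only [instrLaw, Measure.add_apply, Measure.smul_apply, smul_eq_mul]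
  rw [Measure.map_apply Measurable.of_discrete MeasurableSet.of_discrete,
    Measure.dirac_apply' _ MeasurableSet.of_discrete]
  cases i with
  | sleep =>
    have : (Instr.jump ⁻¹' {Instr.sleep} : Set V) = ∅ := by ext; simp
    simp [this, wt]
  | jump w =>
    have h1 : (Instr.jump ⁻¹' {Instr.jump w} : Set V) = {w} := by ext; simp
    have h2 : G.Adj y w := by simpa [instrs] using hi
    rw [h1, stepLaw_toMeasure_singleton G (hG y), if_pos h2]
    simp [wt]

theorem instrLaw_compl (hG : ∀ v, 0 < G.degree v) (y : V) :
    instrLaw G lam y (instrs G y : Set (Instr V))ᶜ = 0 := by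
  classical
  have h : (G.neighborFinset y).Nonempty := by
    rw [← Finset.card_pos, SimpleGraph.card_neighborFinset_eq_degree]
    exact hG y
  simp only [instrLaw, Measure.add_apply, Measure.smul_apply, smul_eq_mul]
  rw [Measure.map_apply Measurable.of_discrete MeasurableSet.of_discrete,
    Measure.dirac_apply' _ MeasurableSet.of_discrete]
  have h1 : (stepLaw G y).toMeasure (Instr.jump ⁻¹' (instrs G y : Set (Instr V))ᶜ) = 0 := by
    rw [PMF.toMeasure_apply_eq_zero_iff _ MeasurableSet.of_discrete, stepLaw, dif_pos h,
      PMF.support_uniformOfFinset]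
    refine Set.disjoint_left.2 fun w hw hw' => hw' ?_
    simpa [instrs] using hw
  rw [h1]
  simp [instrs]

/-- The probability that `x` hosts a sleeping particle after a stabilization of `K` started with
a given number of active particles at each vertex. -/
theorem measure_asleep_le (hG : ∀ v, 0 < G.degree v) (hlam : 0 < lam) (hx : x ∈ K) (n : V → ℕ)
    (H : ℕ) :
    ((H : ℝ≥0∞) + 1) * (Measure.infinitePi (fun q : V × ℕ => instrLaw G lam q.1)
        {τ | ∃ k, AsleepWithin τ K x k (allActive n)} + ENNReal.ofReal (1 / (1 + lam)) ^ H) ≤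
      (H + 1) + ENNReal.ofReal (1 / (1 + lam)) ^ H * green G ((K : Set V)ᶜ) x x := by
  have := fun v => isProbabilityMeasure_instrLaw G hlam v
  rw [green_eq_killedSum hG hx]
  set s := ENNReal.ofReal (lam / (1 + lam))
  set p := ENNReal.ofReal (1 / (1 + lam))
  set ν := Measure.infinitePi (fun q : V × ℕ => instrLaw G lam q.1)
  have hsp : s + p = 1 := by
    rw [← ENNReal.ofReal_add (by positivity) (by positivity), ← add_div, add_comm lam,
      div_self (by positivity), ENNReal.ofReal_one]
  have hp : p ≠ 0 := (ENNReal.ofReal_pos.2 (by positivity)).ne'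
  rcases eq_or_ne (killedSum G K x x) ∞ with hf | hf
  · rw [hf, ENNReal.mul_top (pow_ne_zero _ hp), add_top]
    exact le_top
  have hU : {τ | ∃ k, AsleepWithin τ K x k (allActive n)} =
      ⋃ k, {τ | AsleepWithin τ K x k (allActive n)} := by ext; simp
  have hmono : Monotone fun k => {τ | AsleepWithin τ K x k (allActive n)} :=
    fun k l hkl τ h => AsleepWithin.mono hkl h
  rw [hU, hmono.measure_iUnion, ENNReal.iSup_add,
    ENNReal.mul_iSup]
  refine iSup_le fun k => ?_
  have key := sleeping_bound (G := G) (s := s) (p := p) (K := K) (x := x) hsp hp hG hx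
    (q := fun k η => ν {τ | AsleepWithin τ K x k η}) (fun _ _ => prob_le_one)
    (fun η hη => by simp [not_asleepWithin_zero hη])
    (fun k η hst hη => by simp [not_asleepWithin_of_stable hst hη])
    (fun k η y hy hu => by
      refine (infinitePi_le_sum_first (instrLaw G lam) y (instrs G y) (instrLaw_compl hG y)
        (T := fun i => {τ | AsleepWithin τ K x k (i.perform y η)})
        fun τ hτ => AsleepWithin.step hx hy hu hτ).trans (Finset.sum_le_sum fun i hi => ?_)
      rw [instrLaw_singleton hG y hi])
    k H (allActive n) (by simp [allActive])
  -- Both sides now contain `p ^ H * weakValSup` of the initial configuration, which is finite and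
  -- is cancelled.
  have h2 := key.trans (add_le_add_right
    (mul_le_mul_right (weakValSup_addAt_le hsp hG hx n) (p ^ H)) _)
  rw [mul_add (p ^ H), add_comm (p ^ H * _), ← add_assoc] at h2
  have hpt : p ^ H ≠ ∞ := ENNReal.pow_ne_top ENNReal.ofReal_ne_top
  exact (ENNReal.add_le_add_iff_right
    (ENNReal.mul_ne_top hpt (weakValSup_ne_top hsp hG hx hf _))).1 h2

/-- Only the particle numbers in `K` matter, and they take countably many values `a`. The event is
covered by rectangles over the disjoint sets `C a`, whose measure factorizes even if the second
factor is not measurable. -/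
theorem Q_le_of_forall (hlam : 0 < lam) (mu : ℝ≥0) (hx : x ∈ K) {c : ℝ≥0∞}
    (hc : ∀ n : V → ℕ, Measure.infinitePi (fun q : V × ℕ => instrLaw G lam q.1)
        {τ | ∃ k, AsleepWithin τ K x k (allActive n)} ≤ c) :
    Q G lam mu x K ≤ c := by
  classical
  have := fun v => isProbabilityMeasure_instrLaw G hlam v
  set ν := Measure.infinitePi (fun q : V × ℕ => instrLaw G lam q.1)
  set π := Measure.infinitePi fun _ : V => poissonMeasure mu
  let C : (K → ℕ) → Set (V → ℕ) := fun a => {n | (fun v : K => n v) = a}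
  let e : (K → ℕ) → V → ℕ := fun a v => if h : v ∈ K then a ⟨v, h⟩ else 0
  have hCm : ∀ a, MeasurableSet (C a) := fun a => by
    have : C a = (fun n : V → ℕ => fun v : K => n v) ⁻¹' {a} := by ext; simp [C]
    rw [this]
    exact (measurable_pi_lambda _ fun v => measurable_pi_apply _) (MeasurableSet.singleton a)
  have hCd : Pairwise (Function.onFun Disjoint C) := fun a b hab =>
    Set.disjoint_left.2 fun n hn hn' => hab (hn.symm.trans hn')
  have hsub : {ω : (V → ℕ) × (V × ℕ → Instr V) |
      ∃ η', IsStabilization ω.2 K (fun v => SiteState.active (ω.1 v)) η' ∧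
        η' x = SiteState.sleeping} ⊆
      ⋃ a, C a ×ˢ {τ | ∃ k, AsleepWithin τ K x k (allActive (e a))} := by
    rintro ⟨n, τ⟩ ⟨η', ⟨α, hα, hleg, hfin, hst⟩, hsl⟩
    refine Set.mem_iUnion.2 ⟨fun v : K => n v, rfl, α.length, ?_⟩
    subst hfin
    refine AsleepWithin.congr (η := allActive n) hx (fun v hv => ?_)
      ⟨α, le_rfl, hα, hleg, hst, hsl⟩
    simp [allActive, e, hv]
  calc Q G lam mu x K ≤ _ := measure_mono hsub
    _ ≤ ∑' a, (π.prod ν) (C a ×ˢ {τ | ∃ k, AsleepWithin τ K x k (allActive (e a))}) :=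
        measure_iUnion_le _
    _ ≤ ∑' a, π (C a) * c := by
        refine ENNReal.tsum_le_tsum fun a => ?_
        rw [Measure.prod_prod]
        gcongr
        exact hc _
    _ = π (⋃ a, C a) * c := by rw [ENNReal.tsum_mul_right, measure_iUnion hCd hCm]
    _ ≤ c := mul_le_of_le_one_left' prob_le_one

theorem Q_bound (hG : ∀ v, 0 < G.degree v) (hlam : 0 < lam) (mu : ℝ≥0) (hx : x ∈ K) (H : ℕ) :
    ((H : ℝ≥0∞) + 1) * (Q G lam mu x K + ENNReal.ofReal (1 / (1 + lam)) ^ H) ≤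
      (H + 1) + ENNReal.ofReal (1 / (1 + lam)) ^ H * green G ((K : Set V)ᶜ) x x := by
  set p := ENNReal.ofReal (1 / (1 + lam))
  have h0 : (H : ℝ≥0∞) + 1 ≠ 0 := by simp
  have ht : (H : ℝ≥0∞) + 1 ≠ ∞ := by simp
  have hpt : p ^ H ≠ ∞ := ENNReal.pow_ne_top ENNReal.ofReal_ne_top
  have h := Q_le_of_forall (G := G) hlam mu hx
    (c := ((H + 1) + p ^ H * green G ((K : Set V)ᶜ) x x) / (H + 1) - p ^ H) fun n => by
      refine ENNReal.le_sub_of_add_le_right hpt ?_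
      rw [ENNReal.le_div_iff_mul_le (Or.inl h0) (Or.inl ht), mul_comm]
      exact measure_asleep_le hG hlam hx n H
  -- Ensures that the truncated subtraction in `c` is a genuine one; it follows from `p ≤ 1`.
  have h2 : p ^ H ≤ ((H + 1) + p ^ H * green G ((K : Set V)ᶜ) x x) / (H + 1) := by
    rw [ENNReal.le_div_iff_mul_le (Or.inl h0) (Or.inl ht)]
    refine le_trans ?_ le_self_add
    refine mul_le_of_le_one_left' (pow_le_one' ?_ H)
    refine ENNReal.ofReal_le_one.2 ((div_le_one (by positivity)).2 (by linarith))
  have h3 := (add_le_add_left h (p ^ H)).trans_eq (tsub_add_cancel_of_le h2)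
  rwa [ENNReal.le_div_iff_mul_le (Or.inl h0) (Or.inl ht), mul_comm] at h3

end

end ARW

end

/-! ### Translation of the bound into extended reals -/

theorem theorem3 {V : Type*} [MeasurableSpace V] [DiscreteMeasurableSpace V]
    (G : SimpleGraph V) [G.LocallyFinite] (hG : ∀ v : V, 0 < G.degree v)
    (lam : ℝ) (hlam : 0 < lam) (mu : ℝ≥0) (hmu : 0 < mu)
    (K : Finset V) (x : V) (hx : x ∈ K) (H : ℕ) (hH : 0 < H) :
    (ARW.Q G lam mu x K : EReal) ≤
      1 - (1 - (ARW.green G ((K : Set V)ᶜ) x x : EReal) / ((H : EReal) + 1)) *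
        (((1 / (1 + lam)) ^ H : ℝ) : EReal) := by
  have hb := ARW.Q_bound hG hlam mu hx H
  have hp : 0 < (1 / (1 + lam)) ^ H := by positivity
  rw [← ENNReal.ofReal_pow (by positivity)] at hb
  set r : ℝ := (1 / (1 + lam)) ^ H
  generalize ARW.Q G lam mu x K = Q at *
  generalize ARW.green G ((K : Set V)ᶜ) x x = g at *
  have hH1 : ((H : EReal) + 1) = ((H + 1 : ℝ) : EReal) := by push_cast; rfl
  rw [hH1]
  -- For an infinite Green function, `1 - ⊤ = ⊥` times a positive number is `⊥`, and `1 - ⊥ = ⊤`, as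
  -- the convention demands.
  rcases eq_or_ne g ∞ with rfl | hg
  · rw [EReal.coe_ennreal_top, EReal.top_div_of_pos_ne_top (by exact_mod_cast Nat.cast_add_one_pos H)
      (EReal.coe_ne_top _), EReal.sub_top, EReal.bot_mul_coe_of_pos hp,
      ← EReal.coe_one, EReal.sub_bot (EReal.coe_ne_bot 1)]
    exact le_top
  have hQ : Q ≠ ∞ := by
    rintro rfl
    rw [top_add, ENNReal.mul_top (by simp), top_le_iff] at hb
    exact (ENNReal.add_ne_top.2 ⟨by simp, ENNReal.mul_ne_top ENNReal.ofReal_ne_top hg⟩) hb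
  lift g to ℝ≥0 using hg
  lift Q to ℝ≥0 using hQ
  rw [EReal.coe_nnreal_eq_coe_real, EReal.coe_nnreal_eq_coe_real]
  have hb' : ((H : ℝ) + 1) * (Q + r) ≤ (H + 1) + r * g := by
    rw [ENNReal.ofReal] at hb
    rw [← Real.coe_toNNReal r hp.le]
    exact_mod_cast hb
  have hfin : (Q : ℝ) ≤ 1 - (1 - g / (H + 1)) * r := by
    have hpos : (0 : ℝ) < H + 1 := by positivity
    have : (Q : ℝ) + r ≤ ((H + 1) + r * g) / (H + 1) := by
      rw [le_div_iff₀ hpos]; linarith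
    rw [add_div, div_self hpos.ne'] at this
    calc (Q : ℝ) ≤ 1 + r * g / (H + 1) - r := by linarith
      _ = _ := by ring
  simpa only [EReal.coe_sub, EReal.coe_mul, EReal.coe_div, EReal.coe_one] using
    EReal.coe_le_coe_iff.2 hfin
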